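/- All languages are subsets of $\{0,1\}^*$. Put $\mathrm{BH}_1=\mathrm{NP}$ and, for $k>1$, $\mathrm{BH}_k=\{A\setminus B : A\in\mathrm{NP},\ B\in\mathrm{BH}_{k-1}\}$. For language classes $\mathcal C_1,\mathcal C_2$, let $\mathrm{P}^{\mathcal C_1[1]:\mathcal C_2[1]}$ be the class of languages accepted by deterministic polynomial-time oracle machines that make (at most) one query to an oracle $A\in\mathcal C_1$ followed by (at most) one query to an oracle $B\in\mathcal C_2$; the polynomial time bound and the restriction on the queries hold for all oracles. For $m\ge 1$, let $\mathrm{R}^{p}_{m\text{-tt}}(\mathrm{NP})$ be the class of languages $L$ for which there are $C\in\mathrm{NP}$ and a polynomial-time computable function that, on each input $x$, computes $m$ strings $x_1,\dots,x_m$ and a predicate $\alpha$ of $m$ boolean variables such that $x\in L \iff \alpha(\chi_C(x_1),\dots,\chi_C(x_m))$, where $\chi_C$ is the characteristic function of $C$. **Theorem 3.6.** For all integers $j,k\ge 1$, $$\mathrm{P}^{\mathrm{BH}_j[1]:\mathrm{BH}_k[1]}=\begin{cases}\mathrm{R}^{p}_{(j+2k-1)\text{-tt}}(\mathrm{NP})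 & \text{if } j \text{ is even and } k \text{ is odd},\\ \mathrm{R}^{p}_{(j+2k)\text{-tt}}(\mathrm{NP}) & \text{otherwise.}\end{cases}$$ -/

import Mathlib

/-!
# Query order in the boolean hierarchy: machines and classes

All strings are binary.  One machine model serves for polynomial-time computable functions, for NP
and for oracle access: a finite control working on finitely many stacks of bits (a multi-stack
Turing machine; a tape is a pair of stacks).  Every instruction costs one step.
-/

namespace QueryOrder

/-- The instruction attached to a control state.  `ι` names the available oracles, `K` the stacks
and `Q` the control states. -/
inductive Instr (ι K Q : Type) : Type
  /-- Push the bit `b` on stack `k`. -/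
  | push (k : K) (b : Bool) (next : Q)
  /-- Remove the top bit of stack `k` and branch on it (`none`: the stack is empty). -/
  | pop (k : K) (next : Option Bool → Q)
  /-- A nondeterministic binary choice. -/
  | guess (next : Bool → Q)
  /-- Ask oracle `i` about the string on stack `k` (read from the top) and branch on the answer. -/
  | query (i : ι) (k : K) (next : Bool → Q)
  /-- Stop, and accept (`true`) or reject (`false`). -/
  | halt (verdict : Bool)

/-- A (possibly nondeterministic) machine with oracles named by `ι`. -/
structure Machine (ι : Type) : Type 1 where
  /-- control states -/
  Q : Type
  /-- stacks -/
  K : Type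
  [finQ : Fintype Q]
  [finK : Fintype K]
  [decK : DecidableEq K]
  /-- initial state -/
  start : Q
  /-- the stack that initially holds the input -/
  inp : K
  /-- the stack that holds the output when the machine halts -/
  out : K
  /-- the program -/
  instr : Q → Instr ι K Q

attribute [instance] Machine.finQ Machine.finK Machine.decK

namespace Machine

variable {ι : Type} (M : Machine ι)

/-- Configurations.  `coins` are the outcomes of the nondeterministic choices still to be made;
`asked` records, in chronological order, which oracles have been queried so far. -/
structure Cfg where
  /-- current state -/
  state : M.Q
  /-- stack contents, top first -/
  stk : M.K → List Bool
  /-- outcomes of future choices -/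
  coins : ℕ → Bool
  /-- oracles queried so far -/
  asked : List ι

/-- The initial configuration on input `x`. -/
def init (coins : ℕ → Bool) (x : List Bool) : M.Cfg where
  state := M.start
  stk := Function.update (fun _ => []) M.inp x
  coins := coins
  asked := []

open scoped Classical in
/-- One step of computation with oracles `O`; a halted machine stays where it is. -/
noncomputable def step (O : ι → Language Bool) (c : M.Cfg) : M.Cfg :=
  match M.instr c.state with
  | .push k b q => { c with state := q, stk := Function.update c.stk k (b :: c.stk k) }
  | .pop k next =>
      { c with state := next (c.stk k).head?, stk := Function.update c.stk k (c.stk k).tail }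
  | .guess next => { c with state := next (c.coins 0), coins := fun n => c.coins (n + 1) }
  | .query i k next =>
      { c with state := next (decide (c.stk k ∈ O i)), asked := c.asked ++ [i] }
  | .halt _ => c

/-- The configuration reached from input `x` after `t` steps. -/
noncomputable def run (O : ι → Language Bool) (coins : ℕ → Bool) (x : List Bool) (t : ℕ) : M.Cfg :=
  (M.step O)^[t] (M.init coins x)

/-- The machine never makes a nondeterministic choice. -/
def Deterministic : Prop :=
  ∀ q next, M.instr q ≠ .guess next

/-- Some polynomial in the input length bounds the number of steps before halting, on every
computation path and whatever the oracles are. -/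
def PolyTime : Prop :=
  ∃ p : Polynomial ℕ, ∀ (O : ι → Language Bool) (coins : ℕ → Bool) (x : List Bool),
    ∃ t ≤ p.eval x.length, ∃ b, M.instr (M.run O coins x t).state = .halt b

/-- Some computation path on input `x` accepts (for a deterministic machine there is only one
path). -/
def Accepts (O : ι → Language Bool) (x : List Bool) : Prop :=
  ∃ coins t, M.instr (M.run O coins x t).state = .halt true

end Machine

/-- `f` is computed by a deterministic polynomial-time machine (without oracles). -/
def PolyTimeComputable (f : List Bool → List Bool) : Prop :=
  ∃ M : Machine Empty, M.Deterministic ∧ M.PolyTime ∧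
    ∀ (coins : ℕ → Bool) (x : List Bool), ∃ t b,
      M.instr (M.run Empty.elim coins x t).state = .halt b ∧
        (M.run Empty.elim coins x t).stk M.out = f x

/-- Nondeterministic polynomial time. -/
def NP : Set (Language Bool) :=
  {L | ∃ M : Machine Empty, M.PolyTime ∧ ∀ x, x ∈ L ↔ M.Accepts Empty.elim x}

/-- `C₁ ⊖ C₂`: all differences of a language in `C₁` and a language in `C₂`. -/
def classDiff (C₁ C₂ : Set (Language Bool)) : Set (Language Bool) :=
  {L | ∃ A ∈ C₁, ∃ B ∈ C₂, L = A \ B}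

/-- The levels of the boolean hierarchy over NP: `BH 1 = NP` and `BH k = NP ⊖ BH (k - 1)` for
`k > 1`.  (Level `0` is a convention and not a level of the hierarchy.) -/
def BH : ℕ → Set (Language Bool)
  | 0 => {⊥}
  | 1 => NP
  | k + 2 => classDiff NP (BH (k + 1))

/-- `P^{C₁[1]:C₂[1]}`: the languages accepted by a deterministic polynomial-time oracle machine that
makes one query to an oracle in `C₁` (oracle `0`) followed by one query to an oracle in `C₂`
(oracle `1`).  On each run each oracle is queried at most once, and oracle `0` is not queried after
oracle `1`. -/
def POneOne (C₁ C₂ : Set (Language Bool)) : Set (Language Bool) :=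
  {L | ∃ A ∈ C₁, ∃ B ∈ C₂, ∃ M : Machine (Fin 2), M.Deterministic ∧ M.PolyTime ∧
    (∀ O coins x t, (M.run O coins x t).asked.Sublist [0, 1]) ∧
    ∀ x, x ∈ L ↔ M.Accepts ![A, B] x}

/-- Self-delimiting code of a pair of strings: every bit of `x` is preceded by a `1`, then come a
`0` and the string `y`. -/
def pair (x y : List Bool) : List Bool :=
  x.flatMap (fun b => [true, b]) ++ false :: y

/-- The truth table of an `m`-ary predicate as a string of `2 ^ m` bits: bit number `n` is the value
at the assignment given by the binary digits of `n`. -/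
def truthTable {m : ℕ} (α : (Fin m → Bool) → Bool) : List Bool :=
  List.ofFn fun n : Fin (2 ^ m) => α fun i => (n : ℕ).testBit i

/-- The code of `m` strings together with an `m`-ary predicate, as one string. -/
def encodeTT {m : ℕ} (y : Fin m → List Bool) (α : (Fin m → Bool) → Bool) : List Bool :=
  (List.ofFn y).foldr pair (truthTable α)

open scoped Classical in
/-- `A` is polynomial-time `m`-truth-table reducible to `B`: in polynomial time one computes from
`x` strings `y x 0, …, y x (m - 1)` and a predicate `α x` of `m` boolean variables with
`x ∈ A ↔ α x (χ_B (y x 0), …, χ_B (y x (m - 1)))`. -/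
def TTReducible (m : ℕ) (A B : Language Bool) : Prop :=
  ∃ (y : List Bool → Fin m → List Bool) (α : List Bool → (Fin m → Bool) → Bool),
    PolyTimeComputable (fun x => encodeTT (y x) (α x)) ∧
    ∀ x, x ∈ A ↔ α x (fun i => decide (y x i ∈ B)) = true

/-- `R_{m-tt}^p(C)`: the languages `m`-truth-table reducible to some language in `C`. -/
def RTT (m : ℕ) (C : Set (Language Bool)) : Set (Language Bool) :=
  {L | ∃ B ∈ C, TTReducible m L B}

end QueryOrder

/-!
Both sides are equal to the class of languages decided with at most `m` mind changes: an initial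
guess computed in polynomial time is reversed `N x ≤ m` times, where `N` is a rank all of whose
superlevel sets `{x | c ≤ N x}` are in NP.

A language is in `BH k` exactly if it is the set of `x` with `N x` odd for such a rank `N ≤ k`. For
a machine asking two queries, the rank of the first string and the ranks of the second string after
either answer form a point of the poset `[0, j] × [0, k] × [0, k]`, and the point lies above a given
one on an NP set. The verdict is a function of this point, so the number of mind changes is the
length of an alternating chain, at most `j + 2 * k`. If `j` is even and `k` is odd, parity excludes
a chain of full length. A truth table gives in the same way a point of the cube `{0, 1} ^ m` and at
most `m` changes.

Conversely, `m` queries `c ≤ N x` determine `N x`. For two queries, split `N x` into three pieces of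
lengths at most `k`, `j` and `k`: the first query yields the parity of the middle piece and, with
it, the information which of the outer pieces the second query has to be about.
-/

namespace QueryOrder

open Function

/-! ### Programs on stacks -/

namespace Instr

variable {ι ι' K K' Q Q' : Type}

/-- Rename oracles, stacks and states. -/
def map (i : ι → ι') (f : K → K') (g : Q → Q') : Instr ι K Q → Instr ι' K' Q'
  | .push k b q => .push (f k) b (g q)
  | .pop k n => .pop (f k) fun o => g (n o)
  | .guess n => .guess fun b => g (n b)
  | .query a k n => .query (i a) (f k) fun b => g (n b)
  | .halt b => .halt b

/-- The instruction is a nondeterministic choice. -/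
def IsGuess : Instr ι K Q → Prop
  | .guess _ => True
  | _ => False

theorem isGuess_map (i : ι → ι') (f : K → K') (g : Q → Q') (c : Instr ι K Q) :
    (c.map i f g).IsGuess ↔ c.IsGuess := by
  cases c <;> rfl

end Instr

/-- The part of a configuration that instructions act on: everything except the control state. -/
@[ext]
structure Mem (ι K : Type) where
  /-- stack contents, top first -/
  stk : K → List Bool
  /-- outcomes of future choices -/
  coins : ℕ → Bool
  /-- oracles queried so far -/
  asked : List ι

/-- The memory with `x` on stack `k` and all other stacks empty. -/
def Mem.init {ι K : Type} [DecidableEq K] (k : K) (coins : ℕ → Bool) (x : List Bool) : Mem ι K where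
  stk := update (fun _ => []) k x
  coins := coins
  asked := []

theorem Mem.length_init_le {ι K : Type} [DecidableEq K] (inp k : K) (coins : ℕ → Bool)
    (x : List Bool) : ((Mem.init inp coins x : Mem ι K).stk k).length ≤ x.length := by
  simp only [Mem.init, update_apply]
  split_ifs <;> simp

theorem update_extend {K K' α : Type*} [DecidableEq K] [DecidableEq K'] {f : K → K'}
    (hf : Injective f) (s : K → α) (s₀ : K' → α) (k : K) (v : α) :
    update (extend f s s₀) (f k) v = extend f (update s k v) s₀ := by
  funext k'
  by_cases h : ∃ a, f a = k'
  · obtain ⟨a, rfl⟩ := h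
    simp [update_apply, hf.extend_apply, hf.eq_iff]
  · rw [update_of_ne (fun h' => h ⟨k, h'.symm⟩), extend_apply' _ _ _ h, extend_apply' _ _ _ h]

namespace Instr

variable {ι ι' K K' Q Q' : Type} [DecidableEq K] [DecidableEq K']

open scoped Classical in
/-- The effect of one instruction: the next state and the new memory, `none` after `halt`. -/
noncomputable def next (O : ι → Language Bool) (m : Mem ι K) : Instr ι K Q → Option (Q × Mem ι K)
  | .push k b q => some (q, { m with stk := update m.stk k (b :: m.stk k) })
  | .pop k n => some (n (m.stk k).head?, { m with stk := update m.stk k (m.stk k).tail })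
  | .guess n => some (n (m.coins 0), { m with coins := fun j => m.coins (j + 1) })
  | .query i k n => some (n (decide (m.stk k ∈ O i)), { m with asked := m.asked ++ [i] })
  | .halt _ => none

theorem next_map_id (O : ι → Language Bool) (m : Mem ι K) (c : Instr ι K Q) (g : Q → Q') :
    (c.map id id g).next O m = (c.next O m).map (Prod.map g id) := by
  cases c <;> rfl

theorem next_map {O : ι' → Language Bool} {i : ι → ι'} {f : K → K'} (hf : Injective f)
    (m : Mem ι K) (c : Instr ι K Q) (s : K' → List Bool) (a : List ι') :
    (c.map i f id).next O ⟨extend f m.stk s, m.coins, a ++ m.asked.map i⟩ =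
      (c.next (O ∘ i) m).map
        (Prod.map id fun m => ⟨extend f m.stk s, m.coins, a ++ m.asked.map i⟩) := by
  cases c with
  | query b k n =>
    simp only [Instr.map, next, Option.map_some, Prod.map, id, comp_apply,
      List.map_append, List.map_cons, List.map_nil, List.append_assoc]
    exact congrArg some (Prod.ext
      (congrArg n (decide_eq_decide.2 (by rw [hf.extend_apply]))) rfl)
  | _ => simp [Instr.map, next, update_extend hf, hf.extend_apply]

theorem length_stk_next_le {O : ι → Language Bool} {c : Instr ι K Q} {m m' : Mem ι K} {q : Q}
    (h : c.next O m = some (q, m')) (k : K) : (m'.stk k).length ≤ (m.stk k).length + 1 := by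
  cases c <;> simp only [next, Option.some.injEq, Prod.mk.injEq, reduceCtorEq] at h <;>
    obtain ⟨-, rfl⟩ := h
  case push k' b q' => obtain rfl | hk := eq_or_ne k k' <;> simp [*]
  case pop k' n => obtain rfl | hk := eq_or_ne k k' <;> simp [*]; omega
  all_goals simp

end Instr

/-- A program fragment: a flow chart that is left through one of the exits `E`. -/
structure Block (ι K E : Type) : Type 1 where
  /-- control states -/
  Q : Type
  [finQ : Fintype Q]
  /-- where to begin -/
  start : Q ⊕ E
  /-- the program -/
  instr : Q → Instr ι K (Q ⊕ E)

attribute [instance] Block.finQ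

namespace Block

variable {ι ι' K K' E E' : Type}

/-- The fragment makes no nondeterministic choice. -/
def Det (B : Block ι K E) : Prop := ∀ q, ¬ (B.instr q).IsGuess

section semantics

variable [DecidableEq K] {O : ι → Language Bool} {B : Block ι K E}

/-- `B.Path O r m t e m'`: started at `r` with memory `m`, the fragment is left after `t` steps
through exit `e` with memory `m'`. -/
inductive Path (O : ι → Language Bool) (B : Block ι K E) :
    B.Q ⊕ E → Mem ι K → ℕ → E → Mem ι K → Prop
  | done (e : E) (m : Mem ι K) : Path O B (.inr e) m 0 e m
  | step {q : B.Q} {r : B.Q ⊕ E} {m m₁ m₂ : Mem ι K} {t : ℕ} {e : E} :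
      (B.instr q).next O m = some (r, m₁) → Path O B r m₁ t e m₂ →
        Path O B (.inl q) m (t + 1) e m₂

/-- Started with memory `m`, the fragment is left after at most `T` steps through exit `e` with
memory `m'`. -/
def Runs (O : ι → Language Bool) (B : Block ι K E) (m : Mem ι K) (T : ℕ) (e : E) (m' : Mem ι K) :
    Prop :=
  ∃ t ≤ T, B.Path O B.start m t e m'

theorem Path.unique {r : B.Q ⊕ E} {m m₁ m₂ : Mem ι K} {t₁ t₂ : ℕ} {e₁ e₂ : E}
    (h₁ : B.Path O r m t₁ e₁ m₁) (h₂ : B.Path O r m t₂ e₂ m₂) : e₁ = e₂ ∧ m₁ = m₂ := by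
  induction h₁ generalizing t₂ with
  | done => cases h₂; exact ⟨rfl, rfl⟩
  | step hn _ ih =>
    cases h₂ with
    | step hn' h' =>
      rw [hn] at hn'
      simp only [Option.some.injEq, Prod.mk.injEq] at hn'
      obtain ⟨rfl, rfl⟩ := hn'
      exact ih h'

theorem Runs.unique {m m₁ m₂ : Mem ι K} {T₁ T₂ : ℕ} {e₁ e₂ : E}
    (h₁ : B.Runs O m T₁ e₁ m₁) (h₂ : B.Runs O m T₂ e₂ m₂) : e₁ = e₂ ∧ m₁ = m₂ := by
  obtain ⟨_, _, h₁⟩ := h₁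
  obtain ⟨_, _, h₂⟩ := h₂
  exact h₁.unique h₂

theorem Runs.mono {m m' : Mem ι K} {T T' : ℕ} {e : E} (h : B.Runs O m T e m') (hT : T ≤ T') :
    B.Runs O m T' e m' := by
  obtain ⟨t, ht, h⟩ := h
  exact ⟨t, ht.trans hT, h⟩

theorem Runs.of_eq {m m' m'' : Mem ι K} {T T' : ℕ} {e : E} (h : B.Runs O m T e m') (hT : T ≤ T')
    (hs : ∀ k, m'.stk k = m''.stk k) (hc : m'.coins = m''.coins) (ha : m'.asked = m''.asked) :
    B.Runs O m T' e m'' := by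
  obtain rfl : m' = m'' := Mem.ext (funext hs) hc ha
  exact h.mono hT

theorem Path.length_stk_le {r : B.Q ⊕ E} {m m' : Mem ι K} {t : ℕ} {e : E}
    (h : B.Path O r m t e m') (k : K) : (m'.stk k).length ≤ (m.stk k).length + t := by
  induction h with
  | done => simp
  | step hn _ ih =>
    have := Instr.length_stk_next_le hn k
    omega

theorem Runs.length_stk_le {m m' : Mem ι K} {T : ℕ} {e : E} (h : B.Runs O m T e m') (k : K) :
    (m'.stk k).length ≤ (m.stk k).length + T := by
  obtain ⟨t, ht, h⟩ := h
  exact (h.length_stk_le k).trans (by omega)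

/-- The coins not consumed by a run can be exchanged for others. -/
theorem Path.recoin {r : B.Q ⊕ E} {m m' : Mem ι K} {t : ℕ} {e : E}
    (h : B.Path O r m t e m') (d : ℕ → Bool) :
    ∃ c, B.Path O r { m with coins := c } t e { m' with coins := d } := by
  induction h with
  | done e m => exact ⟨d, .done _ _⟩
  | @step q r m m₁ m₂ t e hn _ ih =>
    obtain ⟨c, hc⟩ := ih
    cases hi : B.instr q <;> rw [hi] at hn <;>
      simp only [Instr.next, Option.some.injEq, Prod.mk.injEq, reduceCtorEq] at hn <;>
      obtain ⟨rfl, rfl⟩ := hn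
    case guess n _ =>
      refine ⟨fun j => Nat.casesOn j (m.coins 0) c, .step (r := n (m.coins 0)) ?_ hc⟩
      rw [hi]
      rfl
    all_goals
      refine ⟨c, .step ?_ hc⟩
      rw [hi]
      rfl

theorem Runs.recoin {m m' : Mem ι K} {T : ℕ} {e : E} (h : B.Runs O m T e m') (d : ℕ → Bool) :
    ∃ c, B.Runs O { m with coins := c } T e { m' with coins := d } := by
  obtain ⟨t, ht, h⟩ := h
  obtain ⟨c, hc⟩ := h.recoin d
  exact ⟨c, t, ht, hc⟩

end semantics

section map

/-- Rename oracles and stacks. -/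
def map (i : ι → ι') (f : K → K') (B : Block ι K E) : Block ι' K' E where
  Q := B.Q
  start := B.start
  instr q := (B.instr q).map i f id

theorem Det.map {B : Block ι K E} (h : B.Det) (i : ι → ι') (f : K → K') : (B.map i f).Det :=
  fun q hq => h q ((Instr.isGuess_map i f id _).1 hq)

variable [DecidableEq K] [DecidableEq K'] {O : ι' → Language Bool} {B : Block ι K E} {i : ι → ι'}
  {f : K → K'}

theorem Path.map (hf : Injective f) {r : B.Q ⊕ E} {m m' : Mem ι K} {t : ℕ} {e : E}
    (h : B.Path (O ∘ i) r m t e m') (s : K' → List Bool) (a : List ι') :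
    (B.map i f).Path O r ⟨extend f m.stk s, m.coins, a ++ m.asked.map i⟩ t e
      ⟨extend f m'.stk s, m'.coins, a ++ m'.asked.map i⟩ := by
  induction h with
  | done => exact .done _ _
  | @step q r m m₁ m₂ t e hn _ ih =>
    refine .step (B := B.map i f) (r := r) ?_ ih
    exact (Instr.next_map hf m (B.instr q) s a).trans (by rw [hn]; rfl)

theorem Runs.map (hf : Injective f) {m m' : Mem ι K} {T : ℕ} {e : E}
    (h : B.Runs (O ∘ i) m T e m') (w : Mem ι' K') (a : List ι') (hs : ∀ k, w.stk (f k) = m.stk k)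
    (hc : w.coins = m.coins) (ha : w.asked = a ++ m.asked.map i) :
    (B.map i f).Runs O w T e ⟨extend f m'.stk w.stk, m'.coins, a ++ m'.asked.map i⟩ := by
  obtain ⟨t, ht, h⟩ := h
  have hw : w = ⟨extend f m.stk w.stk, m.coins, a ++ m.asked.map i⟩ := by
    refine Mem.ext (funext fun k' => ?_) hc ha
    by_cases h : ∃ k, f k = k'
    · obtain ⟨k, rfl⟩ := h
      exact (hs k).trans (hf.extend_apply _ _ _).symm
    · exact (extend_apply' _ _ _ h).symm
  refine ⟨t, ht, ?_⟩
  have key := h.map hf w.stk a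
  rwa [← hw] at key

end map

section constructors

/-- Leave immediately. -/
def ret (e : E) : Block ι K E where
  Q := Empty
  start := .inr e
  instr := Empty.elim

/-- Push a bit. -/
def push (k : K) (b : Bool) : Block ι K Unit where
  Q := Unit
  start := .inl ()
  instr _ := .push k b (.inr ())

/-- Remove the top bit and return it. -/
def pop (k : K) : Block ι K (Option Bool) where
  Q := Unit
  start := .inl ()
  instr _ := .pop k .inr

/-- A nondeterministic bit. -/
def guess : Block ι K Bool where
  Q := Unit
  start := .inl ()
  instr _ := .guess .inr

/-- Return the answer of oracle `i` about the string on stack `k`. -/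
def query (i : ι) (k : K) : Block ι K Bool where
  Q := Unit
  start := .inl ()
  instr _ := .query i k .inr

/-- Where a jump within the first part of a composition leads to. -/
def bindDest (B : Block ι K E) (C : E → Block ι K E') :
    B.Q ⊕ E → (B.Q ⊕ Σ e, (C e).Q) ⊕ E'
  | .inl q => .inl (.inl q)
  | .inr e => Sum.map (fun q => .inr ⟨e, q⟩) id (C e).start

/-- Sequential composition, the second part depending on the exit of the first. -/
def bind [Fintype E] (B : Block ι K E) (C : E → Block ι K E') : Block ι K E' where
  Q := B.Q ⊕ Σ e, (C e).Q
  start := B.bindDest C B.start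
  instr
    | .inl q => (B.instr q).map id id (B.bindDest C)
    | .inr ⟨e, q⟩ => ((C e).instr q).map id id (Sum.map (fun q => .inr ⟨e, q⟩) id)

/-- Sequential composition, whatever the exit of the first part. -/
def seq [Fintype E] (B : Block ι K E) (C : Block ι K E') : Block ι K E' := B.bind fun _ => C

/-- Where a jump within the body of a loop leads to. -/
def loopDest (C : Option Bool → Block ι K (Option E)) (o : Option Bool) :
    (C o).Q ⊕ Option E → (Unit ⊕ Σ o, (C o).Q) ⊕ E
  | .inl q => .inl (.inr ⟨o, q⟩)
  | .inr none => .inl (.inl ())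
  | .inr (some e) => .inr e

/-- Pop a bit from stack `k` and run the body for it, until the body returns a value. -/
def loop (k : K) (C : Option Bool → Block ι K (Option E)) : Block ι K E where
  Q := Unit ⊕ Σ o, (C o).Q
  start := .inl (.inl ())
  instr
    | .inl _ => .pop k fun o => loopDest C o (C o).start
    | .inr ⟨o, q⟩ => ((C o).instr q).map id id (loopDest C o)

theorem det_ret (e : E) : (ret e : Block ι K E).Det := fun q => q.elim
theorem det_push (k : K) (b : Bool) : (push k b : Block ι K Unit).Det := fun _ h => h
theorem det_pop (k : K) : (pop k : Block ι K (Option Bool)).Det := fun _ h => h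
theorem det_query (i : ι) (k : K) : (query i k).Det := fun _ h => h

theorem Det.bind [Fintype E] {B : Block ι K E} {C : E → Block ι K E'} (hB : B.Det)
    (hC : ∀ e, (C e).Det) : (B.bind C).Det := by
  rintro (q | ⟨e, q⟩) h
  · exact hB q ((Instr.isGuess_map _ _ _ _).1 h)
  · exact hC e q ((Instr.isGuess_map _ _ _ _).1 h)

theorem Det.seq [Fintype E] {B : Block ι K E} {C : Block ι K E'} (hB : B.Det) (hC : C.Det) :
    (B.seq C).Det :=
  hB.bind fun _ => hC

theorem Det.loop {k : K} {C : Option Bool → Block ι K (Option E)} (hC : ∀ o, (C o).Det) :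
    (loop k C).Det := by
  rintro (q | ⟨e, q⟩) h
  · exact h
  · exact hC e q ((Instr.isGuess_map _ _ _ _).1 h)

end constructors

section semantics

variable [DecidableEq K] {O : ι → Language Bool}

theorem runs_ret (e : E) (m : Mem ι K) (T : ℕ) : (ret e).Runs O m T e m :=
  ⟨0, Nat.zero_le _, .done _ _⟩

theorem runs_push (k : K) (b : Bool) (m : Mem ι K) :
    (push k b).Runs O m 1 () { m with stk := update m.stk k (b :: m.stk k) } :=
  ⟨1, le_rfl, .step rfl (.done _ _)⟩

theorem runs_pop (k : K) (m : Mem ι K) :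
    (pop k).Runs O m 1 (m.stk k).head? { m with stk := update m.stk k (m.stk k).tail } :=
  ⟨1, le_rfl, .step rfl (.done _ _)⟩

theorem runs_guess (m : Mem ι K) :
    guess.Runs O m 1 (m.coins 0) { m with coins := fun j => m.coins (j + 1) } :=
  ⟨1, le_rfl, .step rfl (.done _ _)⟩

open scoped Classical in
theorem runs_query (i : ι) (k : K) (m : Mem ι K) :
    (query i k).Runs O m 1 (decide (m.stk k ∈ O i)) { m with asked := m.asked ++ [i] } :=
  ⟨1, le_rfl, .step rfl (.done _ _)⟩

theorem Path.bind_right [Fintype E] {B : Block ι K E} {C : E → Block ι K E'} {e : E}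
    {r : (C e).Q ⊕ E'} {m m' : Mem ι K} {t : ℕ} {e' : E'} (h : (C e).Path O r m t e' m') :
    (B.bind C).Path O (Sum.map (fun q => Sum.inr ⟨e, q⟩) id r) m t e' m' := by
  induction h with
  | done => exact .done _ _
  | @step q r m m₁ m₂ t e' hn _ ih =>
    refine .step (B := B.bind C) (q := Sum.inr ⟨e, q⟩) ?_ ih
    exact (Instr.next_map_id _ _ _ _).trans (by rw [hn]; rfl)

theorem Path.bind_left [Fintype E] {B : Block ι K E} {C : E → Block ι K E'} {r : B.Q ⊕ E}
    {m m₁ m₂ : Mem ι K} {t t' : ℕ} {e : E} {e' : E'} (h : B.Path O r m t e m₁)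
    (h' : (C e).Path O (C e).start m₁ t' e' m₂) :
    (B.bind C).Path O (B.bindDest C r) m (t + t') e' m₂ := by
  induction h with
  | done => rw [Nat.zero_add]; exact h'.bind_right
  | @step q r m m₁ m₂ t e hn _ ih =>
    rw [Nat.add_right_comm]
    refine .step (B := B.bind C) (q := Sum.inl q) ?_ (ih h')
    exact (Instr.next_map_id _ _ _ _).trans (by rw [hn]; rfl)

theorem Runs.bind [Fintype E] {B : Block ι K E} {C : E → Block ι K E'} {m m₁ m₂ : Mem ι K}
    {T₁ T₂ : ℕ} {e : E} {e' : E'} (h₁ : B.Runs O m T₁ e m₁) (h₂ : (C e).Runs O m₁ T₂ e' m₂) :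
    (B.bind C).Runs O m (T₁ + T₂) e' m₂ := by
  obtain ⟨t₁, ht₁, h₁⟩ := h₁
  obtain ⟨t₂, ht₂, h₂⟩ := h₂
  exact ⟨t₁ + t₂, by omega, h₁.bind_left h₂⟩

theorem Runs.seq [Fintype E] {B : Block ι K E} {C : Block ι K E'} {m m₁ m₂ : Mem ι K}
    {T₁ T₂ : ℕ} {e : E} {e' : E'} (h₁ : B.Runs O m T₁ e m₁) (h₂ : C.Runs O m₁ T₂ e' m₂) :
    (B.seq C).Runs O m (T₁ + T₂) e' m₂ :=
  h₁.bind h₂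

theorem Path.loop_body {k : K} {C : Option Bool → Block ι K (Option E)} {o : Option Bool} {r}
    {m m₁ : Mem ι K} {t : ℕ} {e : Option E} (h : (C o).Path O r m t e m₁) {t' : ℕ} {e' : E}
    {m₂ : Mem ι K} (h' : (loop k C).Path O (loopDest C o (.inr e)) m₁ t' e' m₂) :
    (loop k C).Path O (loopDest C o r) m (t + t') e' m₂ := by
  induction h with
  | done => rw [Nat.zero_add]; exact h'
  | @step q r m m₁ m₂ t e hn _ ih =>
    rw [Nat.add_right_comm]
    refine .step (B := loop k C) (q := Sum.inr ⟨o, q⟩) ?_ (ih h')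
    exact (Instr.next_map_id _ _ _ _).trans (by rw [hn]; rfl)

theorem Runs.loop_exit {k : K} {C : Option Bool → Block ι K (Option E)} {m m₁ : Mem ι K} {T : ℕ}
    {e : E} (h : (C (m.stk k).head?).Runs O { m with stk := update m.stk k (m.stk k).tail } T
      (some e) m₁) :
    (loop k C).Runs O m (T + 1) e m₁ := by
  obtain ⟨t, ht, h⟩ := h
  exact ⟨t + 1, by omega, .step rfl (h.loop_body (.done _ _))⟩

theorem Runs.loop_next {k : K} {C : Option Bool → Block ι K (Option E)} {m m₁ m₂ : Mem ι K}
    {T T' : ℕ} {e : E} (h : (C (m.stk k).head?).Runs O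
      { m with stk := update m.stk k (m.stk k).tail } T none m₁)
    (h' : (loop k C).Runs O m₁ T' e m₂) :
    (loop k C).Runs O m (T + T' + 1) e m₂ := by
  obtain ⟨t, ht, h⟩ := h
  obtain ⟨t', ht', h'⟩ := h'
  exact ⟨t + t' + 1, by omega, .step rfl (h.loop_body h')⟩

end semantics

end Block

/-! ### Machines from fragments -/

namespace Machine

variable {ι : Type} {M : Machine ι} {O : ι → Language Bool}

/-- A configuration without its control state. -/
def Cfg.mem (c : M.Cfg) : Mem ι M.K := ⟨c.stk, c.coins, c.asked⟩

theorem step_eq_elim (c : M.Cfg) :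
    M.step O c = ((M.instr c.state).next O c.mem).elim c
      fun p => ⟨p.1, p.2.stk, p.2.coins, p.2.asked⟩ := by
  unfold step
  cases M.instr c.state <;> rfl

theorem step_of_halt {c : M.Cfg} {b : Bool} (h : M.instr c.state = .halt b) : M.step O c = c := by
  rw [step_eq_elim, h]
  rfl

theorem run_succ (O : ι → Language Bool) (coins : ℕ → Bool) (x : List Bool) (t : ℕ) :
    M.run O coins x (t + 1) = M.step O (M.run O coins x t) :=
  iterate_succ_apply' _ _ _

theorem run_of_halt {coins : ℕ → Bool} {x : List Bool} {t t' : ℕ} {b : Bool}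
    (h : M.instr (M.run O coins x t).state = .halt b) (ht : t ≤ t') :
    M.run O coins x t' = M.run O coins x t := by
  induction ht with
  | refl => rfl
  | step _ ih => rw [run_succ, ih, step_of_halt h]

theorem run_eq_of_halt {coins : ℕ → Bool} {x : List Bool} {t t' : ℕ} {b b' : Bool}
    (h : M.instr (M.run O coins x t).state = .halt b)
    (h' : M.instr (M.run O coins x t').state = .halt b') :
    M.run O coins x t = M.run O coins x t' ∧ b = b' := by
  have key : M.run O coins x t = M.run O coins x t' := by
    rcases le_total t t' with ht | ht
    · exact (run_of_halt h ht).symm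
    · exact run_of_halt h' ht
  rw [key, h'] at h
  cases h
  exact ⟨key, rfl⟩

end Machine

section toMachine

variable {ι K : Type} [Fintype K] [DecidableEq K]

/-- The machine that runs a fragment and halts with the verdict it returns. -/
def Block.toMachine (B : Block ι K Bool) (inp out : K) : Machine ι where
  Q := B.Q ⊕ Bool
  K := K
  start := B.start
  inp := inp
  out := out
  instr
    | .inl q => B.instr q
    | .inr b => .halt b

theorem Block.Det.toMachine {B : Block ι K Bool} (h : B.Det) (inp out : K) :
    (B.toMachine inp out).Deterministic := by
  rintro (q | b) n (hn : _ = _)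
  · refine h q ?_
    rw [show B.instr q = .guess n from hn]
    trivial
  · cases hn

theorem Block.Path.iterate {O : ι → Language Bool} {B : Block ι K Bool} {inp out : K}
    {r : B.Q ⊕ Bool} {m m' : Mem ι K} {t : ℕ} {b : Bool} (h : B.Path O r m t b m') :
    ((B.toMachine inp out).step O)^[t]
      (⟨r, m.stk, m.coins, m.asked⟩ : (B.toMachine inp out).Cfg) =
      ⟨Sum.inr b, m'.stk, m'.coins, m'.asked⟩ := by
  induction h with
  | done => rfl
  | @step q r m m₁ m₂ t e hn _ ih =>
    rw [iterate_succ_apply, ← ih, Machine.step_eq_elim]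
    exact congrArg _ (congrArg (Option.elim · _ _) hn)

theorem Block.Runs.run {O : ι → Language Bool} {B : Block ι K Bool} {inp out : K} {x : List Bool}
    {coins : ℕ → Bool} {m' : Mem ι K} {T : ℕ} {b : Bool}
    (h : B.Runs O (Mem.init inp coins x) T b m') :
    ∃ t ≤ T, (B.toMachine inp out).run O coins x t =
      ⟨Sum.inr b, m'.stk, m'.coins, m'.asked⟩ := by
  obtain ⟨t, ht, h⟩ := h
  exact ⟨t, ht, h.iterate⟩

theorem Block.Runs.halt {O : ι → Language Bool} {B : Block ι K Bool} {inp out : K} {x : List Bool}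
    {coins : ℕ → Bool} {m' : Mem ι K} {T : ℕ} {b : Bool}
    (h : B.Runs O (Mem.init inp coins x) T b m') :
    ∃ t ≤ T, (B.toMachine inp out).instr ((B.toMachine inp out).run O coins x t).state =
      .halt b := by
  obtain ⟨t, ht, h⟩ := h.run (out := out)
  exact ⟨t, ht, by rw [h]; rfl⟩

theorem Block.Runs.accepts_iff {O : ι → Language Bool} {B : Block ι K Bool} {inp out : K}
    {x : List Bool} {T : (ℕ → Bool) → ℕ} {b : (ℕ → Bool) → Bool} {m' : (ℕ → Bool) → Mem ι K}
    (h : ∀ coins, B.Runs O (Mem.init inp coins x) (T coins) (b coins) (m' coins)) :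
    (B.toMachine inp out).Accepts O x ↔ ∃ coins, b coins = true := by
  constructor
  · rintro ⟨coins, t, ht⟩
    obtain ⟨t', _, ht'⟩ := (h coins).halt (out := out)
    exact ⟨coins, (Machine.run_eq_of_halt ht ht').2.symm⟩
  · rintro ⟨coins, hb⟩
    obtain ⟨t, _, ht⟩ := (h coins).halt (out := out)
    exact ⟨coins, t, hb ▸ ht⟩

end toMachine

/-! ### Fragments from machines -/

/-- Answer the queries by `ans` instead of asking them (an unspecified answer counts as `false`).
The stack `none` is new: pushing on it is what the step spent on a query does. -/
def Instr.answer {ι ι' K Q Q' : Type} (ans : ι → Option Bool) (g : Q → Q') :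
    Instr ι K Q → Instr ι' (Option K) Q'
  | .push k b n => .push (some k) b (g n)
  | .pop k n => .pop (some k) fun o => g (n o)
  | .guess n => .guess fun b => g (n b)
  | .query i _ n => .push none false (g (n (decide (ans i = some true))))
  | .halt b => .halt b

/-- Every string gets the prescribed answer. -/
def constOracle {ι : Type} (ans : ι → Option Bool) (i : ι) : Language Bool :=
  {_y : List Bool | ans i = some true}

/-- The memory with an additional stack `none`, and with another record of queries. -/
def Mem.extend {ι ι' K : Type} (m : Mem ι K) (d : List Bool) (a : List ι') : Mem ι' (Option K) :=
  ⟨Option.elim' d m.stk, m.coins, a⟩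

theorem Mem.extend_init {ι ι' K : Type} [DecidableEq K] (k : K) (coins : ℕ → Bool)
    (x : List Bool) :
    (Mem.init k coins x : Mem ι K).extend [] [] = (Mem.init (some k) coins x : Mem ι' _) := by
  refine Mem.ext (funext fun o => ?_) rfl rfl
  cases o <;> simp [Mem.extend, Mem.init, update_apply]

theorem Instr.next_answer {ι ι' K Q Q' : Type} [DecidableEq K] {O' : ι' → Language Bool}
    (ans : ι → Option Bool) (g : Q → Q') (c : Instr ι K Q) (m : Mem ι K) (d : List Bool)
    (a : List ι') :
    ∃ d', (c.answer ans g).next O' (m.extend d a) =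
      (c.next (constOracle ans) m).map fun p => (g p.1, p.2.extend d' a) := by
  cases c with
  | query i k n =>
    refine ⟨false :: d, congrArg some (Prod.ext (congrArg (g ∘ n) (decide_eq_decide.2 Iff.rfl))
      (Mem.ext ?_ rfl rfl))⟩
    funext o
    cases o <;> simp [Mem.extend]
  | _ => exact ⟨d, by simp [answer, next, Mem.extend, Option.elim'_update]⟩

namespace Machine

variable {ι ι' : Type} {M : Machine ι} {ans : ι → Option Bool}

/-- How a run with answers prescribed by `ans` ends in state `q`, if it does: by halting, or by a
query without a prescribed answer about the string on some stack. -/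
def exit (M : Machine ι) (ans : ι → Option Bool) (q : M.Q) : Option (Bool ⊕ M.K) :=
  match M.instr q with
  | .halt b => some (.inl b)
  | .query i k _ => if ans i = none then some (.inr k) else none
  | _ => none

/-- Where a jump to state `q` leads in `M.sim ans`. -/
def simDest (M : Machine ι) (ans : ι → Option Bool) (q : M.Q) : M.Q ⊕ (Bool ⊕ M.K) :=
  (M.exit ans q).elim (.inl q) .inr

/-- Run a machine with the answers `ans` until it halts or asks an unanswered query. -/
def sim (M : Machine ι) (ans : ι → Option Bool) : Block ι' (Option M.K) (Bool ⊕ M.K) where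
  Q := M.Q
  start := M.simDest ans M.start
  instr q := (M.instr q).answer ans (M.simDest ans)

theorem Deterministic.sim (h : M.Deterministic) (ans : ι → Option Bool) :
    (M.sim ans : Block ι' _ _).Det := by
  intro q (hq : ((M.instr q).answer ans (M.simDest ans)).IsGuess)
  cases hi : M.instr q with
  | guess n => exact h q n hi
  | _ => rw [hi] at hq; exact hq

/-- The run on input `x` with the answers `ans` ends after `t` steps, in the way described by
`e`. -/
def Exits (M : Machine ι) (ans : ι → Option Bool) (coins : ℕ → Bool) (x : List Bool) (t : ℕ)
    (e : Bool ⊕ M.K) : Prop :=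
  M.exit ans (M.run (constOracle ans) coins x t).state = some e ∧
    ∀ s < t, M.exit ans (M.run (constOracle ans) coins x s).state = none

theorem Exits.unique {coins : ℕ → Bool} {x : List Bool} {t t' : ℕ} {e e' : Bool ⊕ M.K}
    (h : M.Exits ans coins x t e) (h' : M.Exits ans coins x t' e') : t = t' ∧ e = e' := by
  obtain rfl : t = t' := by
    refine le_antisymm (not_lt.1 fun hlt => ?_) (not_lt.1 fun hlt => ?_)
    · simpa [h'.1] using h.2 _ hlt
    · simpa [h.1] using h'.2 _ hlt
  exact ⟨rfl, Option.some.inj (h.1.symm.trans h'.1)⟩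

theorem exists_exits_of_halt {coins : ℕ → Bool} {x : List Bool} {t : ℕ} {b : Bool}
    (h : M.instr (M.run (constOracle ans) coins x t).state = .halt b) :
    ∃ t' ≤ t, ∃ e, M.Exits ans coins x t' e := by
  classical
  have hex : ∃ n, (M.exit ans (M.run (constOracle ans) coins x n).state).isSome :=
    ⟨t, by simp [exit, h]⟩
  obtain ⟨e, he⟩ := Option.isSome_iff_exists.1 (Nat.find_spec hex)
  exact ⟨Nat.find hex, Nat.find_min' hex (by simp [exit, h]), e, he, fun s hs => by
    simpa using Nat.find_min hex hs⟩

theorem sim_path {O' : ι' → Language Bool} (a : List ι') {t : ℕ} {c : M.Cfg} {e : Bool ⊕ M.K}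
    (d : List Bool) (he : M.exit ans ((M.step (constOracle ans))^[t] c).state = some e)
    (hlt : ∀ s < t, M.exit ans ((M.step (constOracle ans))^[s] c).state = none) :
    ∃ d', (M.sim ans).Path O' (M.simDest ans c.state) (c.mem.extend d a) t e
      (((M.step (constOracle ans))^[t] c).mem.extend d' a) := by
  induction t generalizing c d with
  | zero =>
    rw [simDest, show M.exit ans c.state = some e from he]
    exact ⟨d, .done _ _⟩
  | succ t ih =>
    have h0 : M.exit ans c.state = none := hlt 0 t.succ_pos
    obtain ⟨d₁, hd₁⟩ := Instr.next_answer (O' := O') ans (M.simDest ans) (M.instr c.state) c.mem d a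
    cases hn : (M.instr c.state).next (constOracle ans) c.mem with
    | none => cases hi : M.instr c.state <;> simp [hi, Instr.next, exit] at hn h0
    | some p =>
      have hs : M.step (constOracle ans) c = ⟨p.1, p.2.stk, p.2.coins, p.2.asked⟩ := by
        rw [step_eq_elim, hn]
        rfl
      obtain ⟨d', hp⟩ := ih (c := M.step (constOracle ans) c) d₁ he fun s h =>
        hlt (s + 1) (by omega)
      refine ⟨d', ?_⟩
      rw [simDest, h0]
      refine .step (B := M.sim ans) (r := M.simDest ans (M.step (constOracle ans) c).state)
        (m₁ := (M.step (constOracle ans) c).mem.extend d₁ a) ?_ hp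
      rw [hs]
      exact hd₁.trans (by rw [hn]; rfl)

theorem Exits.runs_sim {O' : ι' → Language Bool} {coins : ℕ → Bool} {x : List Bool} {t : ℕ}
    {e : Bool ⊕ M.K} (h : M.Exits ans coins x t e) :
    ∃ d, (M.sim ans).Runs O' (Mem.init (some M.inp) coins x) t e
      ((M.run (constOracle ans) coins x t).mem.extend d []) := by
  obtain ⟨d, hp⟩ := sim_path (O' := O') (c := M.init coins x) [] [] h.1 h.2
  exact ⟨d, t, le_rfl, Mem.extend_init (ι := ι) M.inp coins x ▸ hp⟩

end Machine

/-! ### Predicates in NP and in P -/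

theorem monotone_polynomial_eval (p : Polynomial ℕ) : Monotone fun n => p.eval n := by
  intro a b hab
  simp only [Polynomial.eval_eq_sum_range]
  exact Finset.sum_le_sum fun i _ => Nat.mul_le_mul_left _ (Nat.pow_le_pow_left hab i)

/-- With input stack `inp`, on every input `x` and with all outcomes of the choices, the fragment is
left within `p |x|` steps through `e coins x` with memory `m coins x`. -/
def Block.RunsIn {K E : Type} [DecidableEq K] (B : Block Empty K E) (inp : K) (p : Polynomial ℕ)
    (e : (ℕ → Bool) → List Bool → E) (m : (ℕ → Bool) → List Bool → Mem Empty K) : Prop :=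
  ∀ coins x, B.Runs Empty.elim (Mem.init inp coins x) (p.eval x.length) (e coins x) (m coins x)

theorem Block.RunsIn.length_stk_le {K E : Type} [DecidableEq K] {B : Block Empty K E} {inp : K}
    {p : Polynomial ℕ} {e : (ℕ → Bool) → List Bool → E} {m : (ℕ → Bool) → List Bool → Mem Empty K}
    (h : B.RunsIn inp p e m) (coins : ℕ → Bool) (x : List Bool) (k : K) :
    ((m coins x).stk k).length ≤ x.length + p.eval x.length :=
  ((h coins x).length_stk_le k).trans (Nat.add_le_add_right (Mem.length_init_le _ _ _ _) _)

/-- Membership in NP, for predicates. -/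
def IsNP (P : List Bool → Prop) : Prop :=
  ({x | P x} : Language Bool) ∈ NP

/-- Deterministic polynomial time, for predicates. -/
def IsP (P : List Bool → Prop) : Prop :=
  ∃ (K : Type) (_ : Fintype K) (_ : DecidableEq K) (B : Block Empty K Bool) (inp : K)
    (p : Polynomial ℕ) (b : (ℕ → Bool) → List Bool → Bool)
    (m : (ℕ → Bool) → List Bool → Mem Empty K),
    B.Det ∧ B.RunsIn inp p b m ∧ ∀ coins x, P x ↔ b coins x = true

theorem IsNP.congr {P P' : List Bool → Prop} (h : IsNP P) (hP : ∀ x, P' x ↔ P x) : IsNP P' := by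
  obtain rfl : P' = P := funext fun x => propext (hP x)
  exact h

theorem IsP.congr {P P' : List Bool → Prop} (h : IsP P) (hP : ∀ x, P' x ↔ P x) : IsP P' := by
  obtain rfl : P' = P := funext fun x => propext (hP x)
  exact h

/-- The fragment that runs a machine without oracles and returns its verdict. -/
def Machine.toBlock (M : Machine Empty) {ι' : Type} : Block ι' (Option M.K) Bool :=
  (M.sim Empty.elim).bind fun r => .ret (r.elim id fun _ => false)

theorem Machine.Deterministic.toBlock {M : Machine Empty} (h : M.Deterministic) {ι' : Type} :
    (M.toBlock : Block ι' _ _).Det :=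
  (h.sim _).bind fun _ => Block.det_ret _

theorem Machine.exit_oracleFree {M : Machine Empty} {q : M.Q} {e : Bool ⊕ M.K}
    (h : M.exit Empty.elim q = some e) : ∃ b, e = .inl b ∧ M.instr q = .halt b := by
  cases hi : M.instr q with
  | query i => exact i.elim
  | halt b => simp_all [exit]
  | _ => simp [exit, hi] at h

theorem Machine.toBlock_runs {M : Machine Empty} {ι' : Type} {O' : ι' → Language Bool}
    {O : Empty → Language Bool} {coins : ℕ → Bool} {x : List Bool} {t : ℕ} {b : Bool}
    (h : M.instr (M.run O coins x t).state = .halt b) :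
    ∃ d, M.toBlock.Runs O' (Mem.init (some M.inp) coins x) t b
      ((M.run O coins x t).mem.extend d []) := by
  obtain rfl : O = constOracle Empty.elim := Subsingleton.elim _ _
  obtain ⟨t', ht', e, he⟩ := exists_exits_of_halt h
  obtain ⟨b', rfl, hb'⟩ := exit_oracleFree he.1
  obtain ⟨hrun, rfl⟩ := run_eq_of_halt h hb'
  obtain ⟨d, hd⟩ := he.runs_sim (O' := O')
  exact ⟨d, hrun ▸ (hd.bind (Block.runs_ret b _ 0)).mono ht'⟩

theorem Block.RunsIn.isNP {K : Type} [Finite K] [DecidableEq K] {B : Block Empty K Bool} {inp : K}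
    {p : Polynomial ℕ} {b : (ℕ → Bool) → List Bool → Bool}
    {m : (ℕ → Bool) → List Bool → Mem Empty K} (h : B.RunsIn inp p b m) :
    IsNP fun x => ∃ coins, b coins x = true := by
  cases nonempty_fintype K
  refine ⟨B.toMachine inp inp, ⟨p, fun O coins x => ?_⟩, fun x => ?_⟩
  · obtain rfl : O = Empty.elim := Subsingleton.elim _ _
    obtain ⟨t, ht, hb⟩ := (h coins x).halt (out := inp)
    exact ⟨t, ht, _, hb⟩
  · exact (Block.Runs.accepts_iff fun coins => h coins x).symm

theorem IsNP.exists_block {P : List Bool → Prop} (h : IsNP P) :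
    ∃ (K : Type) (_ : Fintype K) (_ : DecidableEq K) (B : Block Empty K Bool) (inp : K)
      (p : Polynomial ℕ) (b : (ℕ → Bool) → List Bool → Bool)
      (m : (ℕ → Bool) → List Bool → Mem Empty K),
      B.RunsIn inp p b m ∧ ∀ x, P x ↔ ∃ coins, b coins x = true := by
  obtain ⟨M, ⟨p, hp⟩, hP⟩ := h
  choose t ht b hb using hp Empty.elim
  choose d hd using fun coins x => Machine.toBlock_runs (O' := Empty.elim) (hb coins x)
  refine ⟨_, inferInstance, inferInstance, M.toBlock, some M.inp, p, b, _,
    fun coins x => (hd coins x).mono (ht coins x), fun x => (hP x).trans ⟨?_, ?_⟩⟩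
  · rintro ⟨coins, s, hs⟩
    exact ⟨coins, (Machine.run_eq_of_halt hs (hb coins x)).2.symm⟩
  · rintro ⟨coins, hx⟩
    exact ⟨coins, t coins x, hx ▸ hb coins x⟩

section followedBy

variable {K E : Type} {K' : E → Type} [∀ e, DecidableEq (K' e)]

/-- Stacks for a fragment run after another one: its input stack is identified with stack `κ e` of
the first fragment, its other stacks are new. -/
def attach (κ : E → K) (inp' : ∀ e, K' e) (e : E) (k : K' e) : K ⊕ Σ e, K' e :=
  if k = inp' e then .inl (κ e) else .inr ⟨e, k⟩

theorem attach_injective (κ : E → K) (inp' : ∀ e, K' e) (e : E) :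
    Injective (attach κ inp' e) := by
  intro a b h
  simp only [attach] at h
  split_ifs at h with ha hb hb
  · rw [ha, hb]
  · simpa using h

variable [Fintype E]

/-- Run a fragment, then one depending on the exit `e`, on the string left on stack `κ e`. -/
def Block.followedBy (B : Block Empty K E) (κ : E → K) (B' : ∀ e, Block Empty (K' e) Bool)
    (inp' : ∀ e, K' e) : Block Empty (K ⊕ Σ e, K' e) Bool :=
  (B.map id Sum.inl).bind fun e => (B' e).map id (attach κ inp' e)

variable [DecidableEq K] [DecidableEq E]

theorem Block.Runs.followedBy {B : Block Empty K E} {κ : E → K} {B' : ∀ e, Block Empty (K' e) Bool}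
    {inp' : ∀ e, K' e} {inp : K} {coins : ℕ → Bool} {x : List Bool} {T T' : ℕ} {e : E}
    {m : Mem Empty K} {m' : Mem Empty (K' e)} {b : Bool}
    (h : B.Runs Empty.elim (Mem.init inp coins x) T e m)
    (h' : (B' e).Runs Empty.elim (Mem.init (inp' e) m.coins (m.stk (κ e))) T' b m') :
    ∃ m'', (B.followedBy κ B' inp').Runs Empty.elim (Mem.init (Sum.inl inp) coins x) (T + T') b
      m'' := by
  refine ⟨_, (Runs.map (O := Empty.elim) (i := id) Sum.inl_injective h _ [] ?_ rfl rfl).bind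
    (Runs.map (O := Empty.elim) (i := id) (attach_injective κ inp' e) h' _ [] ?_ rfl
      (Subsingleton.elim _ _))⟩
  · intro k
    simp [Mem.init, update_apply]
  · intro k
    by_cases hk : k = inp' e
    · subst hk
      simp [attach, Mem.init, Sum.inl_injective.extend_apply]
    · simp [attach, Mem.init, hk]

end followedBy

section ofBlock

variable {K E : Type} [Finite K] [DecidableEq K] [Finite E] {B : Block Empty K E} {inp : K}
  {p : Polynomial ℕ} {e : (ℕ → Bool) → List Bool → E} {m : (ℕ → Bool) → List Bool → Mem Empty K}
  {N : E → List Bool → Prop}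

theorem IsNP.of_block (hB : B.RunsIn inp p e m) (κ : E → K) (hN : ∀ e, IsNP (N e)) :
    IsNP fun x => ∃ coins, N (e coins x) ((m coins x).stk (κ (e coins x))) := by
  classical
  cases nonempty_fintype E
  choose K' _ _ B' inp' q b m' hB' hb using fun e => (hN e).exists_block
  have total : ∀ coins x, ∃ m'', (B.followedBy κ B' inp').Runs Empty.elim
      (Mem.init (Sum.inl inp) coins x) ((p + ∑ e, (q e).comp (Polynomial.X + p)).eval x.length)
      (b (e coins x) (m coins x).coins ((m coins x).stk (κ (e coins x)))) m'' := by
    intro coins x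
    obtain ⟨m'', h⟩ := (hB coins x).followedBy (hB' (e coins x) _ _)
    refine ⟨m'', h.mono ?_⟩
    rw [Polynomial.eval_add, Polynomial.eval_finsetSum]
    refine Nat.add_le_add_left (le_trans ?_ (Finset.single_le_sum
      (f := fun e => ((q e).comp (Polynomial.X + p)).eval x.length) (fun _ _ => Nat.zero_le _)
      (Finset.mem_univ (e coins x)))) _
    simp only [Polynomial.eval_comp, Polynomial.eval_add, Polynomial.eval_X]
    exact monotone_polynomial_eval _ (hB.length_stk_le _ _ _)
  choose m'' hm'' using total
  refine (Block.RunsIn.isNP hm'').congr fun x => ⟨?_, ?_⟩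
  · rintro ⟨coins, hN⟩
    obtain ⟨c, hc⟩ := (hb _ _).1 hN
    obtain ⟨coins', h⟩ := (hB coins x).recoin c
    obtain ⟨he, hm⟩ := (hB coins' x).unique h
    exact ⟨coins', by rwa [he, hm]⟩
  · rintro ⟨coins, h⟩
    exact ⟨coins, (hb _ _).2 ⟨_, h⟩⟩

theorem IsNP.of_det (hB : B.RunsIn inp p e m) (κ : E → K) (hN : ∀ e, IsNP (N e))
    {P : List Bool → Prop}
    (hP : ∀ coins x, P x ↔ N (e coins x) ((m coins x).stk (κ (e coins x)))) : IsNP P :=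
  (IsNP.of_block hB κ hN).congr fun x => by simp only [← hP, exists_const]

end ofBlock

/-! ### Closure properties -/

theorem IsNP.const (P : Prop) : IsNP fun _ => P := by
  classical
  refine (Block.RunsIn.isNP (B := .ret (decide P)) (inp := ()) (p := 0)
    fun coins x => Block.runs_ret _ _ _).congr fun _ => ?_
  simp only [decide_eq_true_eq, exists_const]

theorem IsP.isNP_iff {P : List Bool → Prop} (h : IsP P) (v : Prop) : IsNP fun x => P x ↔ v := by
  obtain ⟨K, _, _, B, inp, p, b, m, -, hB, hP⟩ := h
  exact IsNP.of_det (N := fun b _ => b = true ↔ v) hB (fun _ => inp) (fun b => .const _)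
    fun coins x => by rw [hP coins]

theorem IsNP.or {P P' : List Bool → Prop} (h : IsNP P) (h' : IsNP P') :
    IsNP fun x => P x ∨ P' x := by
  have hB : Block.guess.RunsIn () 1 _ _ := fun coins x =>
    (Block.runs_guess _).mono (by rw [Polynomial.eval_one])
  refine (IsNP.of_block (N := fun b => if b then P else P') hB (fun _ => ()) fun b => ?_).congr
    fun x => ⟨?_, ?_⟩
  · cases b <;> simpa
  · rintro (hx | hx)
    · exact ⟨fun _ => true, by simpa [Mem.init] using hx⟩
    · exact ⟨fun _ => false, by simpa [Mem.init] using hx⟩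
  · rintro ⟨coins, hx⟩
    cases hc : coins 0 <;> simp only [Mem.init, hc, update_self] at hx
    exacts [.inr hx, .inl hx]

theorem IsNP.exists {α : Type*} [Finite α] {P : α → List Bool → Prop} (h : ∀ a, IsNP (P a)) :
    IsNP fun x => ∃ a, P a x := by
  classical
  cases nonempty_fintype α
  have key : ∀ s : Finset α, IsNP fun x => ∃ a ∈ s, P a x := by
    intro s
    induction s using Finset.induction_on with
    | empty => exact (IsNP.const False).congr (by simp)
    | insert a s _ ih => exact ((h a).or ih).congr (by simp)
  exact (key Finset.univ).congr (by simp)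

theorem IsNP.cons {P : List Bool → Prop} (h : IsNP P) (b : Bool) :
    IsNP fun w => ∃ x, w = b :: x ∧ P x := by
  have hB : (Block.pop ()).RunsIn () 1 _ _ := fun coins x =>
    (Block.runs_pop _ _).mono (by rw [Polynomial.eval_one])
  refine IsNP.of_det (N := fun o x => if o = some b then P x else False) hB (fun _ => ())
    (fun o => ?_) fun coins x => ?_
  · split_ifs
    exacts [h, .const _]
  · rcases x with _ | ⟨a, x⟩ <;> simp [Mem.init, eq_comm]

/-! ### Copying strings between stacks -/

namespace Block

variable {ι K : Type}

/-- Push a list of bits, each on its own stack. -/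
def pushAll : List (K × Bool) → Block ι K Unit
  | [] => ret ()
  | p :: l => (push p.1 p.2).seq (pushAll l)

/-- The body of `Block.drain`. -/
def drainBody (w : Bool → List (K × Bool)) : Option Bool → Block ι K (Option Unit)
  | none => ret (some ())
  | some b => (pushAll (w b)).seq (ret none)

/-- Empty stack `k` and push `w b` for every bit `b` of it. -/
def drain (k : K) (w : Bool → List (K × Bool)) : Block ι K Unit :=
  loop k (drainBody w)

/-- The body of `Block.unpair`. -/
def unpairBody (k : K) (w : Bool → List (K × Bool)) : Option Bool → Block ι K (Option Unit)
  | some true => (pop k).bind fun o => drainBody w (some (o.getD false))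
  | _ => ret (some ())

/-- Remove the first component of a pair from stack `k` and push `w b` for every bit `b` of it. -/
def unpair (k : K) (w : Bool → List (K × Bool)) : Block ι K Unit :=
  loop k (unpairBody k w)

theorem det_pushAll (l : List (K × Bool)) : (pushAll l : Block ι K Unit).Det := by
  induction l with
  | nil => exact det_ret _
  | cons p l ih => exact (det_push _ _).seq ih

theorem det_drainBody (w : Bool → List (K × Bool)) :
    ∀ o, (drainBody w o : Block ι K (Option Unit)).Det
  | none => det_ret _
  | some _ => (det_pushAll _).seq (det_ret _)

theorem det_drain (k : K) (w : Bool → List (K × Bool)) : (drain k w : Block ι K Unit).Det :=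
  Det.loop (det_drainBody w)

theorem det_unpair (k : K) (w : Bool → List (K × Bool)) : (unpair k w : Block ι K Unit).Det :=
  Det.loop fun
    | none => det_ret _
    | some false => det_ret _
    | some true => (det_pop _).bind fun _ => det_drainBody w _

variable [DecidableEq K] {O : ι → Language Bool}

/-- The bits that `Block.pushAll` pushes on stack `k`, the last one becoming the top. -/
def bitsFor (k : K) (l : List (K × Bool)) : List Bool :=
  (l.filter fun p => p.1 = k).map Prod.snd

theorem bitsFor_eq_nil {k : K} {l : List (K × Bool)} (h : ∀ p ∈ l, p.1 ≠ k) :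
    bitsFor k l = [] := by
  simpa [bitsFor] using h

theorem runs_pushAll (l : List (K × Bool)) (m : Mem ι K) :
    (pushAll l).Runs O m l.length ()
      { m with stk := fun k => (bitsFor k l).reverse ++ m.stk k } := by
  induction l generalizing m with
  | nil => exact runs_ret _ _ _
  | cons p l ih =>
    refine ((runs_push p.1 p.2 m).seq (ih _)).of_eq (by simp [Nat.add_comm]) (fun k => ?_) rfl rfl
    obtain rfl | hk := eq_or_ne p.1 k
    · simp [bitsFor]
    · simp [bitsFor, hk, hk.symm]

variable {k : K} {w : Bool → List (K × Bool)} {c : ℕ}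

theorem runs_drainBody (hc : ∀ b, (w b).length ≤ c) (b : Bool) (m : Mem ι K) :
    (drainBody w (some b)).Runs O m c none
      { m with stk := fun k => (bitsFor k (w b)).reverse ++ m.stk k } :=
  ((runs_pushAll (w b) m).seq (runs_ret none _ 0)).mono (hc b)

theorem runs_drain (hw : ∀ b, ∀ p ∈ w b, p.1 ≠ k) (hc : ∀ b, (w b).length ≤ c) (x : List Bool)
    (m : Mem ι K) (hm : m.stk k = x) :
    (drain k w).Runs O m (x.length * (c + 1) + 1) ()
      { m with stk := fun k' => if k' = k then [] else
        (x.flatMap fun b => bitsFor k' (w b)).reverse ++ m.stk k' } := by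
  induction x generalizing m with
  | nil =>
    have body : (drainBody w none).Runs O
        { m with stk := update m.stk k (m.stk k).tail } 0 (some ()) _ :=
      runs_ret _ _ _
    rw [show none = (m.stk k).head? by rw [hm]; rfl] at body
    refine (Runs.loop_exit (C := drainBody w) body).of_eq (by simp) (fun k' => ?_) rfl rfl
    by_cases hk : k' = k <;> simp [hk, hm]
  | cons b x ih =>
    have body := runs_drainBody (O := O) hc b { m with stk := update m.stk k (m.stk k).tail }
    rw [show some b = (m.stk k).head? by rw [hm]; rfl] at body
    refine (Runs.loop_next (C := drainBody w) body (ih _ ?_)).of_eq ?_ (fun k' => ?_) rfl rfl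
    · simp [bitsFor_eq_nil (hw b), hm]
    · simp only [List.length_cons, Nat.add_mul]
      omega
    · by_cases hk : k' = k <;> simp [hk]

theorem runs_unpairBody (hc : ∀ b, (w b).length ≤ c) (b : Bool) (m : Mem ι K)
    (hm : (m.stk k).head? = some b) :
    (unpairBody k w (some true)).Runs O m (1 + c) none
      { m with stk := fun k' =>
        (bitsFor k' (w b)).reverse ++ update m.stk k (m.stk k).tail k' } := by
  refine (runs_pop k m).bind ?_
  rw [hm]
  exact runs_drainBody hc b _

theorem runs_unpair (hw : ∀ b, ∀ p ∈ w b, p.1 ≠ k) (hc : ∀ b, (w b).length ≤ c)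
    (x y : List Bool) (m : Mem ι K) (hm : m.stk k = pair x y) :
    (unpair k w).Runs O m (x.length * (c + 2) + 1) ()
      { m with stk := fun k' => if k' = k then y else
        (x.flatMap fun b => bitsFor k' (w b)).reverse ++ m.stk k' } := by
  induction x generalizing m with
  | nil =>
    have body : (unpairBody k w (some false)).Runs O
        { m with stk := update m.stk k (m.stk k).tail } 0 (some ()) _ :=
      runs_ret _ _ _
    rw [show some false = (m.stk k).head? by rw [hm]; rfl] at body
    refine (Runs.loop_exit (C := unpairBody k w) body).of_eq (by simp) (fun k' => ?_) rfl rfl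
    by_cases hk : k' = k <;> simp [hk, hm, pair]
  | cons b x ih =>
    have hm' : m.stk k = true :: b :: pair x y := hm
    have body := runs_unpairBody (O := O) (k := k) hc b
      { m with stk := update m.stk k (m.stk k).tail } (by simp [hm'])
    rw [show some true = (m.stk k).head? by rw [hm']; rfl] at body
    refine (Runs.loop_next (C := unpairBody k w) body (ih _ ?_)).of_eq ?_ (fun k' => ?_) rfl rfl
    · simp [bitsFor_eq_nil (hw b), hm']
    · simp only [List.length_cons, Nat.add_mul]
      omega
    · by_cases hk : k' = k <;> simp [hk]

end Block

section dup

variable {ι K E : Type} {B : Block Empty K E}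

/-- Run a fragment on a copy of the input, which comes on stack `inr 0` and is kept on stack
`inr 2`. -/
def Block.dup (B : Block Empty K E) (inp : K) : Block ι (K ⊕ Fin 3) E :=
  (drain (.inr 0) fun b => [(.inr 1, b)]).seq <|
    (drain (.inr 1) fun b => [(.inr 2, b), (.inl inp, b)]).seq <| B.map Empty.elim Sum.inl

theorem Block.Det.dup (h : B.Det) (inp : K) : (B.dup inp : Block ι _ E).Det :=
  (det_drain _ _).seq <| (det_drain _ _).seq <| h.map _ _

theorem Block.Runs.dup [DecidableEq K] {O : ι → Language Bool} {inp : K} {coins : ℕ → Bool}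
    {x : List Bool} {T : ℕ} {e : E} {m : Mem Empty K}
    (h : B.Runs Empty.elim (Mem.init inp coins x) T e m) :
    (B.dup inp).Runs O (Mem.init (.inr 0) coins x) (5 * x.length + 2 + T) e
      ⟨Sum.elim m.stk fun r => if r = 2 then x else [], m.coins, []⟩ := by
  have reversed : (drain (.inr 0) fun b => [(.inr 1, b)]).Runs O
      (Mem.init (Sum.inr 0 : K ⊕ Fin 3) coins x) (x.length * 2 + 1) ()
      ⟨Sum.elim (fun _ => []) fun r => if r = 1 then x.reverse else [], coins, []⟩ := by
    refine (runs_drain (c := 1) (by simp) (by simp) x _ (by simp [Mem.init])).of_eq le_rfl ?_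
      rfl rfl
    rintro (k | r)
    · simp [bitsFor, Mem.init]
    · fin_cases r <;> simp [bitsFor, Mem.init]
  have copied : (drain (.inr 1) fun b => [(.inr 2, b), (.inl inp, b)]).Runs O
      ⟨Sum.elim (fun _ => []) fun r => if r = 1 then x.reverse else [], coins, []⟩
      (x.length * 3 + 1) () ⟨Sum.elim (update (fun _ => []) inp x) fun r : Fin 3 =>
        if r = 2 then x else [], coins, []⟩ := by
    refine (runs_drain (c := 2) (by simp) (by simp) x.reverse _ (by simp)).of_eq (by simp) ?_
      rfl rfl
    rintro (k | r)
    · by_cases hk : inp = k <;> simp [bitsFor, hk, Ne.symm]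
    · fin_cases r <;> simp [bitsFor]
  rw [Subsingleton.elim Empty.elim (O ∘ Empty.elim)] at h
  have body := Runs.map (O := O) Sum.inl_injective h ⟨Sum.elim (update (fun _ => []) inp x)
    fun r : Fin 3 => if r = 2 then x else [], coins, []⟩ [] (by simp [Mem.init]) rfl rfl
  refine (reversed.seq (copied.seq body)).of_eq (by omega) ?_ rfl
    (by simp [Subsingleton.elim m.asked []])
  rintro (k | r)
  · exact Sum.inl_injective.extend_apply _ _ _
  · exact extend_apply' _ _ _ (by simp)

end dup

theorem IsNP.and {P P' : List Bool → Prop} (h : IsNP P) (h' : IsNP P') :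
    IsNP fun x => P x ∧ P' x := by
  obtain ⟨K, _, _, B, inp, p, b, m, hB, hP⟩ := h.exists_block
  have hB' : (B.dup inp).RunsIn (.inr 0) (5 * Polynomial.X + 2 + p) _ _ := fun coins x =>
    (hB coins x).dup.mono (by simp)
  refine (IsNP.of_block (N := fun b x => b = true ∧ P' x) hB' (fun _ => .inr 2)
    fun b => ?_).congr fun x => ?_
  · cases b
    · exact (IsNP.const False).congr (by simp)
    · exact h'.congr (by simp)
  · simp [hP]

theorem IsNP.forall {α : Type*} [Finite α] {P : α → List Bool → Prop} (h : ∀ a, IsNP (P a)) :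
    IsNP fun x => ∀ a, P a x := by
  classical
  cases nonempty_fintype α
  have key : ∀ s : Finset α, IsNP fun x => ∀ a ∈ s, P a x := by
    intro s
    induction s using Finset.induction_on with
    | empty => exact (IsNP.const True).congr (by simp)
    | insert a s _ ih => exact ((h a).and ih).congr (by simp)
  exact (key Finset.univ).congr (by simp)

/-! ### Ranks with NP superlevel sets -/

/-- All superlevel sets of `N` are in NP. -/
def NPRank (N : List Bool → ℕ) : Prop :=
  ∀ c, IsNP fun x => c ≤ N x

theorem NPRank.comp {N : List Bool → ℕ} (h : NPRank N) {φ : ℕ → ℕ} (hφ : Monotone φ) :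
    NPRank fun x => φ (N x) := by
  classical
  intro c
  by_cases hc : ∃ n, c ≤ φ n
  · exact (h (Nat.find hc)).congr fun x =>
      ⟨fun hx => Nat.find_le hx, fun hx => (Nat.find_spec hc).trans (hφ hx)⟩
  · exact (IsNP.const False).congr fun x => iff_false_intro fun hx => hc ⟨_, hx⟩

open scoped Classical in
theorem NPRank.ite {N : List Bool → ℕ} (h : NPRank N) {P : List Bool → Prop} (hP : IsNP P) :
    NPRank fun x => if P x then N x else 0
  | 0 => (IsNP.const True).congr fun _ => iff_true_intro (Nat.zero_le _)
  | c + 1 => (hP.and (h (c + 1))).congr fun x => by by_cases hx : P x <;> simp [hx]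

/-- The languages `{x | N x is odd}` for ranks `N` with values in `{0, …, k}`. -/
def OddRank (k : ℕ) : Set (Language Bool) :=
  {L | ∃ N, NPRank N ∧ (∀ x, N x ≤ k) ∧ ∀ x, x ∈ L ↔ Odd (N x)}

theorem oddRank_one : OddRank 1 = NP := by
  classical
  ext L
  constructor
  · rintro ⟨N, hN, hle, hL⟩
    refine IsNP.congr (P' := (· ∈ L)) (hN 1) fun x => ?_
    have := hle x
    rw [hL, Nat.odd_iff]
    omega
  · intro hL
    refine ⟨_, NPRank.ite (N := fun _ => 1) (fun c => .const _) (P := (· ∈ L)) hL, fun x => ?_,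
      fun x => ?_⟩ <;>
      by_cases hx : x ∈ L <;> simp [hx]

theorem oddRank_succ (k : ℕ) : OddRank (k + 1) = classDiff NP (OddRank k) := by
  classical
  ext L
  constructor
  · rintro ⟨N, hN, hle, hL⟩
    refine ⟨{x | 1 ≤ N x}, hN 1, {x | Odd (N x - 1)}, ⟨fun x => N x - 1, ?_, fun x => ?_,
      fun x => Iff.rfl⟩, ?_⟩
    · exact hN.comp fun a b h => Nat.sub_le_sub_right h 1
    · exact Nat.sub_le_of_le_add (hle x)
    · ext x
      change x ∈ L ↔ 1 ≤ N x ∧ ¬ Odd (N x - 1)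
      rw [hL, Nat.odd_iff, Nat.odd_iff]
      omega
  · rintro ⟨A, hA, B, ⟨N, hN, hle, hB⟩, rfl⟩
    refine ⟨_, NPRank.ite (hN.comp (φ := (· + 1)) fun a b h => Nat.add_le_add_right h 1)
      (P := (· ∈ A)) hA, fun x => ?_, fun x => ?_⟩
    · have := hle x
      split_ifs <;> omega
    · change x ∈ A ∧ x ∉ B ↔ _
      by_cases hx : x ∈ A <;> simp [hx, hB, Nat.odd_add_one]

theorem BH_eq_oddRank {k : ℕ} (hk : 1 ≤ k) : BH k = OddRank k := by
  induction k, hk using Nat.le_induction with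
  | base => exact oddRank_one.symm
  | succ k hk ih =>
    obtain ⟨k, rfl⟩ := Nat.exists_eq_add_of_le' hk
    rw [oddRank_succ, ← ih]
    rfl

/-- The languages decided with at most `m` mind changes: an initial guess computed in polynomial
time is reversed `N x ≤ m` times. -/
def MindChange (m : ℕ) : Set (Language Bool) :=
  {L | ∃ F, IsP F ∧ ∃ N, NPRank N ∧ (∀ x, N x ≤ m) ∧ ∀ x, x ∈ L ↔ (F x ↔ Even (N x))}

/-! ### Alternation along chains -/

section alternation

variable {X : Type*} [Preorder X] [OrderBot X] {F : X → Prop} {m c : ℕ} {s : X}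

/-- `s` ends a chain from `⊥` along which `F` changes its value `c` times. -/
inductive Alternates (F : X → Prop) : ℕ → X → Prop
  | bot : Alternates F 0 ⊥
  | change {c : ℕ} {s t : X} : Alternates F c s → s ≤ t → ¬ (F s ↔ F t) → Alternates F (c + 1) t

theorem Alternates.iff_even (h : Alternates F c s) : F s ↔ (F ⊥ ↔ Even c) := by
  induction h with
  | bot => simp
  | change _ _ hF ih =>
    rw [Nat.even_add_one]
    tauto

theorem Alternates.le {ρ : X → ℕ} (hρ : ∀ s t, s ≤ t → ¬ (F s ↔ F t) → ρ s < ρ t)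
    (h : Alternates F c s) : c ≤ ρ s := by
  induction h with
  | bot => exact Nat.zero_le _
  | change _ hle hF ih => exact ih.trans_lt (hρ _ _ hle hF)

open scoped Classical in
/-- The maximal number of changes of `F` on a chain from `⊥` that ends below `s`; only chains with
at most `m` changes count. -/
noncomputable def depth (m : ℕ) (F : X → Prop) (s : X) : ℕ :=
  Nat.findGreatest (fun c => ∃ s' ≤ s, Alternates F c s') m

theorem depth_le (m : ℕ) (F : X → Prop) (s : X) : depth m F s ≤ m := by
  classical
  exact Nat.findGreatest_le m

theorem exists_alternates_depth (m : ℕ) (F : X → Prop) (s : X) :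
    ∃ s' ≤ s, Alternates F (depth m F s) s' := by
  classical
  exact Nat.findGreatest_spec (P := fun c => ∃ s' ≤ s, Alternates F c s') (Nat.zero_le m)
    ⟨⊥, bot_le, .bot⟩

theorem Alternates.le_depth {s' : X} (h : Alternates F c s') (hc : c ≤ m) (hs : s' ≤ s) :
    c ≤ depth m F s := by
  classical
  exact Nat.le_findGreatest hc ⟨s', hs, h⟩

theorem iff_even_depth (hm : ∀ c s, Alternates F c s → c ≤ m) (s : X) :
    F s ↔ (F ⊥ ↔ Even (depth m F s)) := by
  obtain ⟨s', hs', h⟩ := exists_alternates_depth m F s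
  rw [← h.iff_even]
  by_contra hF
  have h' := h.change hs' fun h' => hF h'.symm
  exact absurd (h'.le_depth (hm _ _ h') le_rfl) (by omega)

end alternation

theorem mem_mindChange_of_alternates {X : Type*} [Preorder X] [OrderBot X] [Finite X]
    {Γ : Type*} [Finite Γ] {σ : List Bool → X} (hσ : ∀ s, IsNP fun x => s ≤ σ x)
    {g : List Bool → Γ} (hg : ∀ γ, IsNP fun x => g x = γ) {F : Γ → X → Prop}
    (hF : IsP fun x => F (g x) ⊥) {m : ℕ} (hm : ∀ γ c s, Alternates (F γ) c s → c ≤ m)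
    {L : Language Bool} (hL : ∀ x, x ∈ L ↔ F (g x) (σ x)) : L ∈ MindChange m := by
  refine ⟨_, hF, fun x => depth m (F (g x)) (σ x), fun c => ?_, fun x => depth_le _ _ _,
    fun x => (hL x).trans (iff_even_depth (hm _) _)⟩
  refine (IsNP.exists fun γ => IsNP.exists fun s => ((hg γ).and (hσ s)).and
    (IsNP.const (∃ c' ≤ m, c ≤ c' ∧ Alternates (F γ) c' s))).congr fun x => ⟨fun hc => ?_, ?_⟩
  · obtain ⟨s, hs, h⟩ := exists_alternates_depth m (F (g x)) (σ x)
    exact ⟨_, s, ⟨rfl, hs⟩, _, depth_le _ _ _, hc, h⟩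
  · rintro ⟨γ, s, ⟨rfl, hs⟩, c', hc', hle, h⟩
    exact hle.trans (h.le_depth hc' hs)


/-! ### Truth-table reductions have few mind changes -/

theorem length_pair (x y : List Bool) : (pair x y).length = 2 * x.length + 1 + y.length := by
  simp only [pair, List.length_append, List.length_flatMap, List.length_cons, List.length_nil,
    List.map_const', List.sum_replicate, smul_eq_mul]
  omega

namespace Block

variable {ι K : Type}

/-- Remove the first components of `n` nested pairs from stack `k`. -/
def skip (k : K) : ℕ → Block ι K Unit
  | 0 => ret ()
  | n + 1 => (unpair k fun _ => []).seq (skip k n)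

/-- Remove `n` bits from stack `k`. -/
def popN (k : K) : ℕ → Block ι K Unit
  | 0 => ret ()
  | n + 1 => (pop k).seq (popN k n)

/-- Return bit number `n` of the truth table in the code of `m` strings and a predicate on stack
`k`. -/
def tableBit (k : K) (m n : ℕ) : Block ι K Bool :=
  (skip k m).seq <| (popN k n).seq <| (pop k).bind fun o => ret (o.getD false)

/-- Extract string number `i` from the code on stack `k` to stack `r₁`, using stack `r₀`. -/
def component (k r₀ r₁ : K) (i : ℕ) : Block ι K Unit :=
  (skip k i).seq <| (unpair k fun b => [(r₀, b)]).seq <| drain r₀ fun b => [(r₁, b)]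

theorem det_skip (k : K) (n : ℕ) : (skip k n : Block ι K Unit).Det := by
  induction n with
  | zero => exact det_ret _
  | succ n ih => exact (det_unpair _ _).seq ih

theorem det_popN (k : K) (n : ℕ) : (popN k n : Block ι K Unit).Det := by
  induction n with
  | zero => exact det_ret _
  | succ n ih => exact (det_pop _).seq ih

theorem det_tableBit (k : K) (m n : ℕ) : (tableBit k m n : Block ι K Bool).Det :=
  (det_skip _ _).seq <| (det_popN _ _).seq <| (det_pop _).bind fun _ => det_ret _

variable [DecidableEq K] {O : ι → Language Bool}

theorem runs_skip {k : K} (l : List (List Bool)) (w : List Bool) (n : ℕ) (hn : n ≤ l.length)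
    (m : Mem ι K) (hm : m.stk k = l.foldr pair w) :
    (skip k n).Runs O m (l.foldr pair w).length ()
      { m with stk := update m.stk k ((l.drop n).foldr pair w) } := by
  induction n generalizing l m with
  | zero =>
    refine (runs_ret () m _).of_eq le_rfl (fun k' => ?_) rfl rfl
    by_cases hk : k' = k
    · subst hk
      simpa using hm
    · simp [hk]
  | succ n ih =>
    obtain _ | ⟨x, l⟩ := l
    · simp at hn
    · have head := runs_unpair (O := O) (w := fun _ => []) (c := 0) (by simp) (by simp) x
        (l.foldr pair w) m hm
      refine (head.seq (ih l (by simpa using hn) _ (by simp))).of_eq ?_ (fun k' => ?_) rfl rfl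
      · rw [List.foldr_cons, length_pair]
        omega
      · by_cases hk : k' = k <;> simp [hk, bitsFor]

theorem runs_popN (k : K) (n : ℕ) (m : Mem ι K) :
    (popN k n).Runs O m n () { m with stk := update m.stk k ((m.stk k).drop n) } := by
  induction n generalizing m with
  | zero => exact (runs_ret () m _).of_eq le_rfl (fun k' => by simp) rfl rfl
  | succ n ih =>
    exact ((runs_pop k m).seq (ih _)).of_eq (by omega) (fun k' => by simp) rfl rfl

theorem runs_tableBit {a : ℕ} (y : Fin a → List Bool) (α : (Fin a → Bool) → Bool) (n : ℕ)
    {k : K} (m : Mem ι K) (hm : m.stk k = encodeTT y α) :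
    ∃ m', (tableBit k a n).Runs O m ((encodeTT y α).length + n + 1)
      ((truthTable α)[n]?.getD false) m' := by
  have skipped := runs_skip (O := O) (List.ofFn y) (truthTable α) a (by simp) m hm
  rw [List.drop_of_length_le (by simp)] at skipped
  have bit (m : Mem ι K) : ((pop k).bind fun o => ret (o.getD false)).Runs O m 1
      ((m.stk k).head?.getD false) _ :=
    (runs_pop k m).bind (C := fun o => ret (o.getD false)) (runs_ret _ _ 0)
  have found := skipped.seq ((runs_popN k n _).seq (bit _))
  simp only [update_self, List.head?_drop, List.foldr_nil] at found
  exact ⟨_, found.mono (Nat.add_assoc _ _ _).ge⟩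

theorem runs_component {k r₀ r₁ : K} (h₀ : r₀ ≠ k) (h₁ : r₁ ≠ k) (h₂ : r₁ ≠ r₀) {a : ℕ}
    (y : Fin a → List Bool) (α : (Fin a → Bool) → Bool) (i : Fin a) (m : Mem ι K)
    (hm : m.stk k = encodeTT y α) (hr₀ : m.stk r₀ = []) (hr₁ : m.stk r₁ = []) :
    ∃ m', (component k r₀ r₁ i).Runs O m (6 * (encodeTT y α).length + 2) () m' ∧
      m'.stk r₁ = y i := by
  obtain ⟨w, hw⟩ : ∃ w, ((List.ofFn y).drop i).foldr pair (truthTable α) = pair (y i) w := by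
    rw [List.drop_eq_getElem_cons (by simp)]
    exact ⟨_, by simp; rfl⟩
  have skipped := runs_skip (O := O) (List.ofFn y) (truthTable α) i (by simp) m hm
  rw [hw] at skipped
  have reversed := runs_unpair (O := O) (w := fun b => [(r₀, b)]) (c := 1) (by simp [h₀])
    (by simp) (y i) w { m with stk := update m.stk k (pair (y i) w) } (update_self _ _ _)
  have extracted (m' : Mem ι K) (hm' : m'.stk r₀ = (y i).reverse) :=
    runs_drain (O := O) (w := fun b => [(r₁, b)]) (c := 1) (by simp [h₂]) (by simp) _ m' hm'
  refine ⟨_, (skipped.seq (reversed.seq (extracted _ ?_))).mono ?_, ?_⟩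
  · simp [bitsFor, h₀, hr₀]
  · have length_le := skipped.length_stk_le k
    simp only [update_self, length_pair, hm] at length_le
    simp only [List.length_reverse, encodeTT] at length_le ⊢
    omega
  · simp [bitsFor, h₁, h₂, h₂.symm, hr₁]

end Block

theorem PolyTimeComputable.exists_block {f : List Bool → List Bool} (h : PolyTimeComputable f) :
    ∃ (K : Type) (_ : Fintype K) (_ : DecidableEq K) (B : Block Empty K Unit) (inp out : K)
      (p : Polynomial ℕ) (m : (ℕ → Bool) → List Bool → Mem Empty K),
      B.Det ∧ B.RunsIn inp p (fun _ _ => ()) m ∧ ∀ coins x, (m coins x).stk out = f x := by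
  obtain ⟨M, hdet, ⟨p, hp⟩, hf⟩ := h
  choose t ht b hb using hp Empty.elim
  choose d hd using fun coins x => Machine.toBlock_runs (O' := Empty.elim) (hb coins x)
  refine ⟨_, inferInstance, inferInstance, M.toBlock.seq (.ret ()), some M.inp, some M.out, p, _,
    hdet.toBlock.seq (Block.det_ret _),
    fun coins x => ((hd coins x).seq (Block.runs_ret () _ 0)).mono (ht coins x), fun coins x => ?_⟩
  obtain ⟨t', b', hb', hout⟩ := hf coins x
  rw [← hout, ← (Machine.run_eq_of_halt (hb coins x) hb').1]
  rfl

section truthTable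

variable {m : ℕ} {y : List Bool → Fin m → List Bool} {α : List Bool → (Fin m → Bool) → Bool}

theorem getElem?_truthTable_ofBits (α : (Fin m → Bool) → Bool) (v : Fin m → Bool) :
    (truthTable α)[Nat.ofBits v]? = some (α v) := by
  simp [truthTable, Nat.ofBits_lt_two_pow]

theorem PolyTimeComputable.isP_table (h : PolyTimeComputable fun x => encodeTT (y x) (α x))
    (v : Fin m → Bool) : IsP fun x => α x v = true := by
  obtain ⟨K, _, _, B, inp, out, p, mem, hdet, hB, hout⟩ := h.exists_block
  choose mem' hbit using fun coins x => Block.runs_tableBit (O := Empty.elim) (y x) (α x)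
    (Nat.ofBits v) (mem coins x) (hout coins x)
  refine ⟨K, inferInstance, inferInstance, B.seq (Block.tableBit out m (Nat.ofBits v)), inp,
    2 * p + Polynomial.X + ((Nat.ofBits v + 1 : ℕ) : Polynomial ℕ), fun _ x => α x v, mem',
    hdet.seq (Block.det_tableBit _ _ _), fun coins x => ?_, fun _ _ => Iff.rfl⟩
  have length_le := hB.length_stk_le coins x out
  have run := (hB coins x).seq (hbit coins x)
  rw [getElem?_truthTable_ofBits] at run
  refine run.mono ?_
  rw [hout] at length_le
  simp only [Polynomial.eval_add, Polynomial.eval_mul, Polynomial.eval_ofNat, Polynomial.eval_X,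
    Polynomial.eval_natCast, Nat.cast_id]
  omega

theorem PolyTimeComputable.isNP_component (h : PolyTimeComputable fun x => encodeTT (y x) (α x))
    {N : List Bool → Prop} (hN : IsNP N) (i : Fin m) : IsNP fun x => N (y x i) := by
  obtain ⟨K, _, _, B, inp, out, p, mem, -, hB, hout⟩ := h.exists_block
  have computed (coins) (x) := (hB coins x).map (O := Empty.elim) (i := id)
    (Sum.inl_injective (β := Fin 2)) (Mem.init (.inl inp) coins x) []
    (by simp [Mem.init, update_apply]) rfl rfl
  have empty (coins x) (r : Fin 2) : extend Sum.inl (mem coins x).stk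
      (Mem.init (.inl inp : K ⊕ Fin 2) coins x : Mem Empty _).stk (.inr r) = [] := by
    rw [extend_apply' _ _ _ (by simp)]
    simp [Mem.init]
  choose mem' extracted hmem' using fun coins x => Block.runs_component (O := Empty.elim)
    (k := .inl out) (r₀ := .inr 0) (r₁ := .inr 1) (by simp) (by simp) (by simp) (y x) (α x) i
    ⟨extend Sum.inl (mem coins x).stk _, (mem coins x).coins, _⟩
    ((Sum.inl_injective.extend_apply _ _ _).trans (hout coins x)) (empty coins x 0)
    (empty coins x 1)
  have total : Block.RunsIn _ (Sum.inl inp : K ⊕ Fin 2) (7 * p + 6 * Polynomial.X + 2) _ _ :=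
    fun coins x => ((computed coins x).seq (extracted coins x)).mono <| by
      have length_le := hB.length_stk_le coins x out
      rw [hout] at length_le
      simp only [Polynomial.eval_add, Polynomial.eval_mul, Polynomial.eval_ofNat,
        Polynomial.eval_X]
      omega
  exact IsNP.of_det (N := fun _ => N) total (fun _ => .inr 1) (fun _ => hN)
    fun coins x => by rw [hmem']

end truthTable

theorem Alternates.le_card {m c : ℕ} {F : (Fin m → Bool) → Prop} {v : Fin m → Bool}
    (h : Alternates F c v) : c ≤ m := by
  refine (h.le (ρ := fun s => (Finset.univ.filter fun i => s i = true).card) ?_).trans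
    ((Finset.card_le_univ _).trans_eq (Fintype.card_fin m))
  intro s t hst hF
  refine Finset.card_lt_card (Finset.ssubset_iff_subset_ne.2 ⟨fun i => ?_, fun heq => hF ?_⟩)
  · simp only [Finset.mem_filter, Finset.mem_univ, true_and]
    exact fun hi => Bool.eq_true_of_true_le (hi ▸ hst i)
  · have : s = t := funext fun i => Bool.eq_iff_iff.2 (by simpa using Finset.ext_iff.1 heq i)
    rw [this]

theorem RTT_subset_mindChange (m : ℕ) : RTT m NP ⊆ MindChange m := by
  classical
  rintro L ⟨B, hB, y, α, hf, hL⟩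
  refine mem_mindChange_of_alternates (σ := fun x i => decide (y x i ∈ B)) (g := α)
    (F := fun γ v => γ v = true) (fun s => ?_) (fun γ => ?_) (hf.isP_table _)
    (fun _ _ _ => Alternates.le_card) hL
  · exact IsNP.forall fun i => ((IsNP.const (s i = false)).or
      (hf.isNP_component (N := (· ∈ B)) hB i)).congr fun x => by
        rw [Bool.le_iff_imp, decide_eq_true_eq, ← Bool.not_eq_true]
        exact imp_iff_not_or
  · exact (IsNP.forall fun v => (hf.isP_table v).isNP_iff (γ v = true)).congr fun x =>
      funext_iff.trans (forall_congr' fun v => Bool.eq_iff_iff)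

/-! ### Two queries have few mind changes -/

namespace Machine

variable {ι : Type} {M : Machine ι} {O : ι → Language Bool} {ans : ι → Option Bool}
  {coins : ℕ → Bool} {x : List Bool}

theorem Deterministic.run_coins (h : M.Deterministic) (O : ι → Language Bool)
    (coins coins' : ℕ → Bool) (x : List Bool) (t : ℕ) :
    M.run O coins x t = { M.run O coins' x t with coins := coins } := by
  induction t with
  | zero => rfl
  | succ t ih =>
    rw [run_succ, run_succ, ih]
    generalize M.run O coins' x t = c
    unfold step
    dsimp only
    cases hi : M.instr c.state with
    | guess n => exact absurd hi (h _ _)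
    | _ => rfl

theorem asked_prefix_succ (O : ι → Language Bool) (coins : ℕ → Bool) (x : List Bool) (t : ℕ) :
    (M.run O coins x t).asked <+: (M.run O coins x (t + 1)).asked := by
  rw [run_succ]
  generalize M.run O coins x t = c
  unfold step
  cases hi : M.instr c.state <;> simp

theorem asked_prefix (O : ι → Language Bool) (coins : ℕ → Bool) (x : List Bool) {s t : ℕ}
    (h : s ≤ t) : (M.run O coins x s).asked <+: (M.run O coins x t).asked := by
  induction h with
  | refl => exact List.prefix_rfl
  | step _ ih => exact ih.trans (asked_prefix_succ O coins x _)

theorem asked_query {t : ℕ} {i : ι} {k : M.K} {n : Bool → M.Q}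
    (h : M.instr (M.run O coins x t).state = .query i k n) :
    (M.run O coins x (t + 1)).asked = (M.run O coins x t).asked ++ [i] := by
  rw [run_succ]
  unfold step
  rw [h]

theorem not_halt_of_query {s t : ℕ} {i : ι} {k : M.K} {n : Bool → M.Q} {b : Bool}
    (h : M.instr (M.run O coins x t).state = .query i k n) (hs : s ≤ t) :
    M.instr (M.run O coins x s).state ≠ .halt b := by
  intro hb
  rw [run_of_halt hb hs, hb] at h
  cases h

/-- Up to step `t`, the oracles give the prescribed answers. -/
def Agrees (M : Machine ι) (O : ι → Language Bool) (ans : ι → Option Bool) (coins : ℕ → Bool)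
    (x : List Bool) (t : ℕ) : Prop :=
  ∀ s < t, ∀ i k n, M.instr (M.run O coins x s).state = .query i k n →
    ∃ b, ans i = some b ∧ (b = true ↔ (M.run O coins x s).stk k ∈ O i)

theorem Agrees.run_eq {t : ℕ} (h : M.Agrees O ans coins x t) :
    M.run (constOracle ans) coins x t = M.run O coins x t := by
  induction t with
  | zero => rfl
  | succ t ih =>
    rw [run_succ, run_succ, ih fun s hs => h s (by omega)]
    have ht := h t (by omega)
    generalize M.run O coins x t = c at ht
    unfold step
    cases hi : M.instr c.state with
    | query i k n =>
      obtain ⟨b, hb, hiff⟩ := ht i k n hi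
      refine congrArg (fun b => (⟨n b, c.stk, c.coins, c.asked ++ [i]⟩ : M.Cfg))
        (decide_eq_decide.2 ?_)
      rw [← hiff]
      change ans i = some true ↔ _
      rw [hb, Option.some_inj]
    | _ => rfl

/-- How the deterministic run on input `x` with the answers `ans` ends: with a verdict, or with a
query without a prescribed answer about some string. -/
def Outcome (M : Machine ι) (ans : ι → Option Bool) (x : List Bool) (r : Bool ⊕ List Bool) : Prop :=
  ∃ t e, M.Exits ans (fun _ => false) x t e ∧
    e.map id (M.run (constOracle ans) (fun _ => false) x t).stk = r

theorem Outcome.unique {r r' : Bool ⊕ List Bool} (h : M.Outcome ans x r) (h' : M.Outcome ans x r') :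
    r = r' := by
  obtain ⟨t, e, he, rfl⟩ := h
  obtain ⟨t', e', he', rfl⟩ := h'
  obtain ⟨rfl, rfl⟩ := he.unique he'
  rfl

theorem Agrees.outcome {t : ℕ} {e : Bool ⊕ M.K} (h : M.Agrees O ans (fun _ => false) x t)
    (hhalt : ∀ s < t, ∀ b, M.instr (M.run O (fun _ => false) x s).state ≠ .halt b)
    (he : M.exit ans (M.run O (fun _ => false) x t).state = some e) :
    M.Outcome ans x (e.map id (M.run O (fun _ => false) x t).stk) := by
  refine ⟨t, e, ⟨h.run_eq ▸ he, fun s hs => ?_⟩, by rw [h.run_eq]⟩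
  rw [Agrees.run_eq fun r hr => h r (hr.trans hs), exit]
  cases hi : M.instr (M.run O (fun _ => false) x s).state with
  | halt b => exact absurd hi (hhalt s hs b)
  | query i k n =>
    obtain ⟨b, hb, -⟩ := h s hs i k n hi
    exact if_neg (by simp [hb])
  | _ => rfl

theorem Deterministic.exists_runs_sim (hdet : M.Deterministic) {t : ℕ} {b : Bool}
    (h : M.instr (M.run (constOracle ans) coins x t).state = .halt b) :
    ∃ e m, (M.sim ans : Block Empty _ _).Runs Empty.elim (Mem.init (some M.inp) coins x) t e m ∧
      M.Outcome ans x (e.map id fun k => m.stk (some k)) := by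
  obtain ⟨t', ht', e, he⟩ := exists_exits_of_halt h
  obtain ⟨d, hd⟩ := he.runs_sim (O' := Empty.elim)
  refine ⟨e, _, hd.mono ht', t', e, ?_, ?_⟩
  · simpa only [Exits, hdet.run_coins _ coins fun _ => false] using he
  · rw [hdet.run_coins _ coins fun _ => false]
    rfl

theorem isP_outcome (hdet : M.Deterministic) (hpoly : M.PolyTime) (ans : ι → Option Bool) :
    IsP fun x => M.Outcome ans x (.inl true) := by
  obtain ⟨p, hp⟩ := hpoly
  choose t ht b hb using hp (constOracle ans)
  choose e m hrun hout using fun coins x => hdet.exists_runs_sim (hb coins x)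
  refine ⟨Option M.K, inferInstance, inferInstance,
    (M.sim ans).bind fun e => .ret (e.elim id fun _ => false), some M.inp, p,
    fun coins x => (e coins x).elim id fun _ => false, m,
    (hdet.sim _).bind fun _ => Block.det_ret _,
    fun coins x => ((hrun coins x).bind (C := fun e => .ret (e.elim id fun _ => false))
      (Block.runs_ret _ _ 0)).mono (ht coins x), fun coins x => ?_⟩
  have verdict := hout coins x
  change _ ↔ (e coins x).elim id (fun _ => false) = true
  cases he : e coins x with
  | inl v =>
    rw [he, Sum.map_inl] at verdict
    exact ⟨fun h => Sum.inl.inj (verdict.unique h), fun h => h ▸ verdict⟩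
  | inr k =>
    rw [he] at verdict
    exact iff_of_false (fun h => by cases h.unique verdict) Bool.false_ne_true

theorem isNP_outcome (hdet : M.Deterministic) (hpoly : M.PolyTime) (ans : ι → Option Bool)
    {P : List Bool → Prop} (hP : IsNP P) : IsNP fun x => ∃ y, M.Outcome ans x (.inr y) ∧ P y := by
  obtain ⟨p, hp⟩ := hpoly
  choose t ht b hb using hp (constOracle ans)
  choose e m hrun hout using fun coins x => hdet.exists_runs_sim (hb coins x)
  have total : Block.RunsIn _ _ p e m := fun coins x => (hrun coins x).mono (ht coins x)
  refine IsNP.of_det (N := Sum.elim (fun _ _ => False) fun _ => P) total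
    (Sum.elim (fun _ => none) some) (Sum.forall.2 ⟨fun _ => .const _, fun _ => hP⟩)
    fun coins x => ?_
  have verdict := hout coins x
  cases he : e coins x with
  | inl v =>
    rw [he] at verdict
    exact iff_false_intro fun ⟨y, hy, _⟩ => by cases hy.unique verdict
  | inr k =>
    rw [he, Sum.map_inr] at verdict
    refine ⟨fun ⟨y, hy, h⟩ => ?_, fun h => ⟨_, verdict, h⟩⟩
    rwa [Sum.inr.inj (hy.unique verdict)] at h

open scoped Classical in
/-- The rank of the string in the first query without a prescribed answer, `0` if there is no such
query. -/
noncomputable def queryRank (M : Machine ι) (ans : ι → Option Bool) (N : List Bool → ℕ)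
    (x : List Bool) : ℕ :=
  if h : ∃ y, M.Outcome ans x (.inr y) then N h.choose else 0

theorem queryRank_iff {N : List Bool → ℕ} {P : ℕ → Prop} (hP : ¬ P 0) :
    P (M.queryRank ans N x) ↔ ∃ y, M.Outcome ans x (.inr y) ∧ P (N y) := by
  by_cases h : ∃ y, M.Outcome ans x (.inr y)
  · rw [queryRank, dif_pos h]
    refine ⟨fun hN => ⟨_, h.choose_spec, hN⟩, fun ⟨y, hy, hN⟩ => ?_⟩
    rwa [Sum.inr.inj (h.choose_spec.unique hy)]
  · rw [queryRank, dif_neg h]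
    exact iff_of_false hP fun ⟨y, hy, _⟩ => h ⟨y, hy⟩

theorem queryRank_le {N : List Bool → ℕ} {n : ℕ} (hN : ∀ y, N y ≤ n) (ans : ι → Option Bool)
    (x : List Bool) : M.queryRank ans N x ≤ n := by
  by_contra h
  obtain ⟨y, -, hy⟩ := (queryRank_iff (P := (n < ·)) (Nat.not_lt_zero n)).1 (not_le.1 h)
  exact (hN y).not_gt hy

theorem npRank_queryRank (hdet : M.Deterministic) (hpoly : M.PolyTime) (ans : ι → Option Bool)
    {N : List Bool → ℕ} (hN : NPRank N) : NPRank (M.queryRank ans N)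
  | 0 => (IsNP.const True).congr fun _ => iff_true_intro (Nat.zero_le _)
  | c + 1 => (isNP_outcome hdet hpoly ans (hN (c + 1))).congr fun _ =>
      queryRank_iff (P := (c + 1 ≤ ·)) (Nat.not_succ_le_zero c)

section twoQueries

variable {M : Machine (Fin 2)} {O : Fin 2 → Language Bool} {x : List Bool} {a b : Bool}

theorem query_order (hord : ∀ O coins x t, (M.run O coins x t).asked.Sublist [0, 1])
    {coins : ℕ → Bool} {s t : ℕ} {i i' : Fin 2} {k k' : M.K} {n n' : Bool → M.Q} (hst : s < t)
    (hs : M.instr (M.run O coins x s).state = .query i k n)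
    (ht : M.instr (M.run O coins x t).state = .query i' k' n') : i = 0 ∧ i' = 1 := by
  have hprefix : (M.run O coins x s).asked ++ [i] <+: (M.run O coins x t).asked :=
    asked_query hs ▸ asked_prefix O coins x hst
  have hsub : [i, i'].Sublist [0, 1] :=
    (((List.sublist_append_right _ _).trans hprefix.sublist).append_right [i']).trans
      (asked_query ht ▸ hord O coins x (t + 1))
  simpa using hsub.eq_of_length rfl

-- A query to oracle `0` is the first one, so the answer prescribed for oracle `1` is irrelevant.
theorem outcome_query_zero (hord : ∀ O coins x t, (M.run O coins x t).asked.Sublist [0, 1])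
    {s : ℕ} {k : M.K} {n : Bool → M.Q}
    (hs : M.instr (M.run O (fun _ => false) x s).state = .query 0 k n) :
    M.Outcome ![none, some false] x (.inr ((M.run O (fun _ => false) x s).stk k)) :=
  Agrees.outcome (e := .inr k) (O := O)
    (fun _ hr _ _ _ hq => absurd (query_order hord hr hq hs).2 zero_ne_one)
    (fun _ hr _ => not_halt_of_query hs hr.le) (by simp [exit, hs])

theorem outcome_query_one (hord : ∀ O coins x t, (M.run O coins x t).asked.Sublist [0, 1])
    (ha : ∀ s k n, M.instr (M.run O (fun _ => false) x s).state = .query 0 k n →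
      (a = true ↔ (M.run O (fun _ => false) x s).stk k ∈ O 0))
    {s : ℕ} {k : M.K} {n : Bool → M.Q}
    (hs : M.instr (M.run O (fun _ => false) x s).state = .query 1 k n) :
    M.Outcome ![some a, none] x (.inr ((M.run O (fun _ => false) x s).stk k)) := by
  refine Agrees.outcome (e := .inr k) (O := O) (fun r hr i k' n' hq => ⟨a, ?_⟩)
    (fun _ hr _ => not_halt_of_query hs hr.le) (by simp [exit, hs])
  obtain rfl := (query_order hord hr hq hs).1
  exact ⟨rfl, ha r k' n' hq⟩

theorem agrees_of_answers (hord : ∀ O coins x t, (M.run O coins x t).asked.Sublist [0, 1])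
    (ha : a = true ↔ ∃ y, M.Outcome ![none, some false] x (.inr y) ∧ y ∈ O 0)
    (hb : b = true ↔ ∃ y, M.Outcome ![some a, none] x (.inr y) ∧ y ∈ O 1) (t : ℕ) :
    M.Agrees O ![some a, some b] (fun _ => false) x t := by
  have correct {P : List Bool → Prop} {ans : Fin 2 → Option Bool} {y : List Bool}
      (hy : M.Outcome ans x (.inr y)) : (∃ y, M.Outcome ans x (.inr y) ∧ P y) ↔ P y :=
    ⟨fun ⟨y', hy', h⟩ => Sum.inr.inj (hy'.unique hy) ▸ h, fun h => ⟨y, hy, h⟩⟩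
  have ha' : ∀ s k n, M.instr (M.run O (fun _ => false) x s).state = .query 0 k n →
      (a = true ↔ (M.run O (fun _ => false) x s).stk k ∈ O 0) :=
    fun s k n hs => ha.trans (correct (outcome_query_zero hord hs))
  intro s _ i k n hs
  obtain rfl | rfl : i = 0 ∨ i = 1 := by omega
  · exact ⟨a, rfl, ha' s k n hs⟩
  · exact ⟨b, rfl, hb.trans (correct (outcome_query_one hord ha' hs))⟩

theorem accepts_iff_outcome (hdet : M.Deterministic) (hpoly : M.PolyTime)
    (hord : ∀ O coins x t, (M.run O coins x t).asked.Sublist [0, 1])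
    (ha : a = true ↔ ∃ y, M.Outcome ![none, some false] x (.inr y) ∧ y ∈ O 0)
    (hb : b = true ↔ ∃ y, M.Outcome ![some a, none] x (.inr y) ∧ y ∈ O 1) :
    M.Accepts O x ↔ M.Outcome ![some a, some b] x (.inl true) := by
  classical
  have hhalt : ∃ t v, M.instr (M.run O (fun _ => false) x t).state = .halt v := by
    obtain ⟨p, hp⟩ := hpoly
    obtain ⟨t, -, h⟩ := hp O (fun _ => false) x
    exact ⟨t, h⟩
  obtain ⟨v, hv⟩ := Nat.find_spec hhalt
  have verdict : M.Outcome ![some a, some b] x (.inl v) :=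
    (agrees_of_answers hord ha hb _).outcome (e := .inl v)
      (fun s hs v' h => Nat.find_min hhalt hs ⟨v', h⟩) (by simp only [exit, hv])
  constructor
  · rintro ⟨coins, t, ht⟩
    rw [hdet.run_coins _ _ fun _ => false] at ht
    exact (run_eq_of_halt ht hv).2 ▸ verdict
  · intro h
    obtain rfl : v = true := Sum.inl.inj (verdict.unique h)
    exact ⟨_, _, hv⟩

end twoQueries

end Machine

/-! ### The verdict as a function of ranks -/

/-- Whether two queries lead to acceptance, as a function of the ranks of the strings asked about:
`s.1` for the first query and `s.2 a` for the second query after the answer `a`.  An answer is the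
parity of the rank, and `γ` is the verdict in terms of the two answers. -/
def twoQueryVerdict {j k : ℕ} (γ : Bool → Bool → Bool) (s : Fin (j + 1) × (Bool → Fin (k + 1))) :
    Prop :=
  γ (decide (Odd s.1.val)) (decide (Odd (s.2 (decide (Odd s.1.val))).val)) = true

section twoQueryVerdict

variable {j k c : ℕ} {γ : Bool → Bool → Bool} {s : Fin (j + 1) × (Bool → Fin (k + 1))}

theorem Alternates.le_add_add (h : Alternates (twoQueryVerdict γ) c s) :
    c ≤ s.1.val + (s.2 false).val + (s.2 true).val := by
  refine h.le (ρ := fun s => s.1.val + (s.2 false).val + (s.2 true).val) fun s t hst hne => ?_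
  have h₁ : s.1.val ≤ t.1.val := hst.1
  have h₂ (a : Bool) : (s.2 a).val ≤ (t.2 a).val := hst.2 a
  have hf := h₂ false
  have ht := h₂ true
  by_contra hlt
  obtain rfl : s = t :=
    Prod.ext (Fin.ext (by omega)) (funext fun a => Fin.ext (by cases a <;> omega))
  exact hne Iff.rfl

theorem Alternates.le_add_of_const (hγ : ∀ b, γ false b = γ false false)
    (h : Alternates (twoQueryVerdict γ) c s) : c ≤ s.1.val + (s.2 true).val := by
  refine h.le (ρ := fun s => s.1.val + (s.2 true).val) fun s t hst hne => ?_
  have h₁ : s.1.val ≤ t.1.val := hst.1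
  have h₂ : (s.2 true).val ≤ (t.2 true).val := hst.2 true
  by_contra hlt
  have hfst : s.1 = t.1 := Fin.ext (by omega)
  have hsnd : s.2 true = t.2 true := Fin.ext (by omega)
  refine hne ?_
  rw [twoQueryVerdict, twoQueryVerdict, hfst]
  cases decide (Odd t.1.val)
  · rw [hγ, hγ (decide _)]
  · rw [hsnd]

theorem Alternates.le_add_two_mul (h : Alternates (twoQueryVerdict γ) c s) : c ≤ j + 2 * k := by
  have := h.le_add_add
  omega

/-- A chain with `j + 2 * k` changes ends at the top.  As `j` is even and `k` is odd, the answers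
there are negative and positive, whereas both are negative at `⊥`.  An even number of changes
preserves the verdict, so the second answer does not matter after a negative first one. -/
theorem Alternates.le_of_even_of_odd (hj : Even j) (hk : Odd k)
    (h : Alternates (twoQueryVerdict γ) c s) : c ≤ j + 2 * k - 1 := by
  have hle := h.le_add_add
  by_contra hc
  obtain rfl : c = j + 2 * k := by omega
  have hfst : s.1.val = j := by omega
  have hsnd : (s.2 false).val = k := by omega
  have hbot : twoQueryVerdict γ (⊥ : Fin (j + 1) × (Bool → Fin (k + 1))) ↔ γ false false = true :=
    Iff.rfl
  have htop : twoQueryVerdict γ s ↔ γ false true = true := by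
    simp [twoQueryVerdict, hfst, hsnd, hk, Nat.not_odd_iff_even.2 hj]
  have hγ : γ false true = γ false false := by
    have := h.iff_even
    rwa [htop, hbot, iff_true_right (hj.add (even_two_mul k)), ← Bool.eq_iff_iff] at this
  have := h.le_add_of_const (Bool.forall_bool.2 ⟨rfl, hγ⟩)
  have := hk.pos
  omega

end twoQueryVerdict

theorem POneOne_subset_mindChange {j k m : ℕ}
    (hm : ∀ γ c s, Alternates (twoQueryVerdict (j := j) (k := k) γ) c s → c ≤ m) :
    POneOne (OddRank j) (OddRank k) ⊆ MindChange m := by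
  classical
  rintro L ⟨A, ⟨NA, hNA, hAle, hA⟩, B, ⟨NB, hNB, hBle, hB⟩, M, hdet, hpoly, hord, hL⟩
  have lt_succ {N : List Bool → ℕ} {n : ℕ} (hN : ∀ y, N y ≤ n) (ans : Fin 2 → Option Bool)
      (x : List Bool) : M.queryRank ans N x < n + 1 :=
    Nat.lt_succ_of_le (Machine.queryRank_le hN ans x)
  have verdict := Machine.isP_outcome hdet hpoly
  refine mem_mindChange_of_alternates (X := Fin (j + 1) × (Bool → Fin (k + 1)))
    (σ := fun x => (⟨M.queryRank ![none, some false] NA x, lt_succ hAle _ x⟩,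
      fun a => ⟨M.queryRank ![some a, none] NB x, lt_succ hBle _ x⟩))
    (g := fun x a b => decide (M.Outcome ![some a, some b] x (.inl true)))
    (F := twoQueryVerdict) (fun s => ?_) (fun γ => ?_) ?_ hm fun x => (hL x).trans ?_
  · exact (Machine.npRank_queryRank hdet hpoly _ hNA s.1).and
      (IsNP.forall fun a => Machine.npRank_queryRank hdet hpoly _ hNB (s.2 a))
  · exact (IsNP.forall fun a => IsNP.forall fun b => (verdict _).isNP_iff (γ a b = true)).congr
      fun x => funext_iff.trans <| forall_congr' fun a => funext_iff.trans <|
        forall_congr' fun b => Bool.eq_iff_iff.trans (iff_congr decide_eq_true_iff Iff.rfl)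
  · exact (verdict ![some false, some false]).congr fun x => decide_eq_true_iff
  · refine (Machine.accepts_iff_outcome hdet hpoly hord ?_ ?_).trans decide_eq_true_iff.symm
    · simp only [decide_eq_true_iff, Matrix.cons_val_zero, hA]
      exact Machine.queryRank_iff Nat.not_odd_zero
    · simp only [decide_eq_true_iff, Matrix.cons_val_one, Matrix.cons_val_zero, hB]
      exact Machine.queryRank_iff Nat.not_odd_zero

/-! ### Two queries handle many mind changes -/

section twoQueries

variable {K : Type} {B : Block Empty K Bool} {inp : K}

/-- Ask oracle `0` about the string on stack `k`, then oracle `1` about this string with the first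
answer put in front; return both answers. -/
def Block.askTwice (k : K) : Block (Fin 2) K (Bool × Bool) :=
  (query 0 k).bind fun a => (push k a).seq <| (query 1 k).bind fun b => ret (a, b)

/-- Decide by `v` from the value returned by a fragment and the answers to two queries. -/
def Block.twoQueries (B : Block Empty K Bool) (inp : K) (v : Bool → Bool → Bool → Bool) :
    Block (Fin 2) (K ⊕ Fin 3) Bool :=
  (B.dup inp).bind fun f => (askTwice (.inr 2)).bind fun ab => ret (v f ab.1 ab.2)

theorem Block.det_askTwice (k : K) : (askTwice k).Det :=
  (det_query _ _).bind fun _ => (det_push _ _).seq <| (det_query _ _).bind fun _ => det_ret _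

theorem Block.Det.twoQueries (h : B.Det) (inp : K) (v : Bool → Bool → Bool → Bool) :
    (B.twoQueries inp v).Det :=
  (h.dup inp).bind fun _ => (det_askTwice _).bind fun _ => det_ret _

variable [DecidableEq K] {O : Fin 2 → Language Bool}

open scoped Classical in
theorem Block.runs_askTwice (k : K) (m : Mem (Fin 2) K) :
    ∃ s, (askTwice k).Runs O m 3 (decide (m.stk k ∈ O 0),
      decide (decide (m.stk k ∈ O 0) :: m.stk k ∈ O 1)) ⟨s, m.coins, m.asked ++ [0] ++ [1]⟩ := by
  have second (a : Bool) := runs_query (O := O) 1 k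
    ⟨update m.stk k (a :: m.stk k), m.coins, m.asked ++ [0]⟩
  simp only [update_self] at second
  exact ⟨_, (runs_query 0 k m).bind (C := fun a => (push k a).seq <|
    (query 1 k).bind fun b => ret (a, b)) ((runs_push k _ _).seq
      ((second _).bind (C := fun b => ret (_, b)) (runs_ret _ _ 0)))⟩

open scoped Classical in
theorem Block.Runs.twoQueries (v : Bool → Bool → Bool → Bool) {coins : ℕ → Bool} {x : List Bool}
    {T : ℕ} {f : Bool} {m : Mem Empty K} (h : B.Runs Empty.elim (Mem.init inp coins x) T f m) :
    ∃ m', m'.asked = [0, 1] ∧ (B.twoQueries inp v).Runs O (Mem.init (.inr 0) coins x)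
      (5 * x.length + 5 + T) (v f (decide (x ∈ O 0)) (decide (decide (x ∈ O 0) :: x ∈ O 1)))
      m' := by
  obtain ⟨s, asked⟩ := runs_askTwice (O := O) (.inr 2)
    ⟨Sum.elim m.stk fun r : Fin 3 => if r = 2 then x else [], m.coins, []⟩
  simp only [Sum.elim_inr, if_true] at asked
  exact ⟨_, rfl, (h.dup.bind (C := fun f => (askTwice (.inr 2)).bind fun ab => ret (v f ab.1 ab.2))
    (asked.bind (C := fun ab => ret (v f ab.1 ab.2)) (runs_ret _ _ 0))).mono (by omega)⟩

end twoQueries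

theorem Block.Runs.asked_prefix {ι K : Type} [Fintype K] [DecidableEq K] {B : Block ι K Bool}
    {O : ι → Language Bool} {inp : K} {coins : ℕ → Bool} {x : List Bool} {T : ℕ} {b : Bool}
    {m : Mem ι K} (h : B.Runs O (Mem.init inp coins x) T b m) (out : K) (t : ℕ) :
    ((B.toMachine inp out).run O coins x t).asked <+: m.asked := by
  obtain ⟨t', -, ht'⟩ := h.run (out := out)
  obtain hle | hle := le_total t t'
  · simpa only [ht'] using Machine.asked_prefix (M := B.toMachine inp out) O coins x hle
  · rw [Machine.run_of_halt (M := B.toMachine inp out) (b := b) (by rw [ht']; rfl) hle, ht']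

open scoped Classical in
theorem mem_POneOne_of_answers {C₁ C₂ : Set (Language Bool)} {F : List Bool → Prop} (hF : IsP F)
    {A B L : Language Bool} (hA : A ∈ C₁) (hB : B ∈ C₂) (v : Bool → Bool → Bool → Bool)
    (hL : ∀ x, x ∈ L ↔
      v (decide (F x)) (decide (x ∈ A)) (decide (decide (x ∈ A) :: x ∈ B)) = true) :
    L ∈ POneOne C₁ C₂ := by
  obtain ⟨K, _, _, D, inp, p, b, m, hdet, hD, hb⟩ := hF
  obtain rfl : b = fun _ x => decide (F x) :=
    funext fun coins => funext fun x => Bool.eq_iff_iff.2 ((hb coins x).symm.trans (by simp))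
  choose m' asked run using fun O coins x => (hD coins x).twoQueries (O := O) v
  refine ⟨A, hA, B, hB, (D.twoQueries inp v).toMachine (.inr 0) (.inr 0),
    (hdet.twoQueries inp v).toMachine _ _,
    ⟨5 * Polynomial.X + 5 + p, fun O coins x => ?_⟩, fun O coins x t => ?_, fun x => ?_⟩
  · obtain ⟨t, ht, h⟩ := (run O coins x).halt (out := .inr 0)
    exact ⟨t, by simpa using ht, _, h⟩
  · exact asked O coins x ▸ ((run O coins x).asked_prefix _ t).sublist
  · rw [Block.Runs.accepts_iff fun coins => run ![A, B] coins x, exists_const]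
    exact hL x

theorem NPRank.elim_cons {N : Bool → List Bool → ℕ} (h : ∀ a, NPRank (N a)) :
    NPRank fun w => w.casesOn 0 N
  | 0 => (IsNP.const True).congr fun _ => iff_true_intro (Nat.zero_le _)
  | c + 1 => (IsNP.exists fun a => (h a (c + 1)).cons a).congr fun w => by
      rcases w with _ | ⟨a, x⟩ <;> simp

/-- The rank of the first query when `n` mind changes are split into pieces of lengths at most
`k`, `i` and `k`; a possible further change counts as well. -/
def firstRank (i k n : ℕ) : ℕ :=
  min (n - k) i + (n - (i + 2 * k))

/-- The rank of the second query after the answer `a`: the last or the first piece. -/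
def secondRank (i k : ℕ) (a : Bool) (n : ℕ) : ℕ :=
  if a then min (n - k - i) k else min n k

/-- A positive first answer shows that the middle piece has begun; so the first one is exhausted and
only the last one is unknown. A negative answer shows that the middle piece is not exhausted, as `i`
is odd; so the last one has not begun. The exception `n = i + 1 + 2 * k`, where the additional
change makes the first answer negative, does no harm: there `n` and the second rank `k` are both
even. -/
theorem even_iff_split {i k e n : ℕ} (hi : Odd i) (he : e = 0 ∨ e = 1 ∧ Even k)
    (hn : n ≤ i + e + 2 * k) {a b : Bool} (ha : a = true ↔ Odd (firstRank i k n))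
    (hb : b = true ↔ Odd (secondRank i k a n)) :
    Even n ↔ (if a then b == decide (Even k) else !b) = true := by
  rw [Nat.odd_iff] at hi ha hb
  rw [Nat.even_iff] at he ⊢
  unfold firstRank at ha
  unfold secondRank at hb
  cases a
  · simp only [Bool.false_eq_true, false_iff, if_false] at ha hb ⊢
    rw [Bool.not_eq_true', ← Bool.not_eq_true, hb]
    omega
  · simp only [true_iff, if_true] at ha hb ⊢
    rw [beq_iff_eq, Bool.eq_iff_iff, hb, decide_eq_true_iff, Nat.even_iff]
    omega

theorem mindChange_subset_POneOne {i j k e : ℕ} (hi : Odd i) (hij : i + e ≤ j)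
    (he : e = 0 ∨ e = 1 ∧ Even k) :
    MindChange (i + e + 2 * k) ⊆ POneOne (OddRank j) (OddRank k) := by
  classical
  rintro L ⟨F, hF, N, hN, hle, hL⟩
  have first : NPRank fun x => firstRank i k (N x) :=
    hN.comp fun n n' h => by unfold firstRank; omega
  have second (a : Bool) : NPRank fun x => secondRank i k a (N x) :=
    hN.comp fun n n' h => by unfold secondRank; split_ifs <;> omega
  let N₂ : List Bool → ℕ := fun w => w.casesOn 0 fun a x => secondRank i k a (N x)
  have hN₂ w : N₂ w ≤ k := by
    rcases w with _ | ⟨_ | _, x⟩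
    exacts [Nat.zero_le _, min_le_right _ _, min_le_right _ _]
  refine mem_POneOne_of_answers (A := {x | Odd (firstRank i k (N x))}) (B := {w | Odd (N₂ w)}) hF
    ⟨_, first, fun x => ?_, fun _ => Iff.rfl⟩ ⟨N₂, .elim_cons second, hN₂, fun _ => Iff.rfl⟩
    (fun f a b => f == if a then b == decide (Even k) else !b) fun x => ?_
  · have := hle x
    unfold firstRank
    omega
  · rw [hL, beq_iff_eq, Bool.eq_iff_iff, decide_eq_true_iff]
    exact iff_congr .rfl
      (even_iff_split hi he (hle x) decide_eq_true_iff decide_eq_true_iff)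

/-! ### Truth-table reductions handle many mind changes -/

/-- The string `x` tagged with the number `c`. -/
def tag (c : ℕ) (x : List Bool) : List Bool :=
  List.replicate c true ++ false :: x

theorem tag_inj {c c' : ℕ} {x x' : List Bool} : tag c x = tag c' x' ↔ c = c' ∧ x = x' := by
  induction c generalizing c' with
  | zero => cases c' <;> simp [tag, List.replicate_succ]
  | succ c ih => cases c' with
    | zero => simp [tag, List.replicate_succ]
    | succ c' => simpa [tag, List.replicate_succ] using ih

theorem IsNP.tag {P : List Bool → Prop} (h : IsNP P) (c : ℕ) :
    IsNP fun w => ∃ x, w = tag c x ∧ P x := by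
  induction c with
  | zero => exact h.cons false
  | succ c ih =>
    refine (ih.cons true).congr fun w => ⟨?_, ?_⟩
    · rintro ⟨x, rfl, hx⟩
      exact ⟨_, rfl, x, rfl, hx⟩
    · rintro ⟨_, rfl, x, rfl, hx⟩
      exact ⟨x, rfl, hx⟩

theorem pair_tag (c : ℕ) (x w : List Bool) :
    pair (tag c x) w = List.replicate (2 * c + 1) true ++ false :: pair x w := by
  induction c with
  | zero => rfl
  | succ c ih =>
    calc pair (tag (c + 1) x) w = true :: true :: pair (tag c x) w := rfl
      _ = _ := by rw [ih]; rfl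

namespace Block

variable {ι : Type}

/-- Replace the string `w` on stack `0` by `pair x w`, where `x` is the string on stack `2`. -/
def prependPair : Block ι (Fin 3) Unit :=
  (push 0 false).seq <| (drain 2 fun b => [(1, b)]).seq <|
    drain 1 fun b => [(2, b), (0, b), (0, true)]

/-- Replace the string `w` on stack `0` by `pair (tag c x) w`, where `x` is the string on stack
`2`. -/
def prependTag (c : ℕ) : Block ι (Fin 3) Unit :=
  prependPair.seq <| pushAll ((0, false) :: List.replicate (2 * c + 1) (0, true))

/-- `Block.prependTag` for several tags, the last one coming first. -/
def prependTags : List ℕ → Block ι (Fin 3) Unit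
  | [] => ret ()
  | c :: l => (prependTags l).seq (prependTag c)

/-- Write the code of the strings `tag i x`, `i < m`, and of `α` on stack `0`, where `x` is the
string on stack `2`. -/
def writeTags {m : ℕ} (α : (Fin m → Bool) → Bool) : Block ι (Fin 3) Unit :=
  (pushAll ((truthTable α).reverse.map fun b => (0, b))).seq <| prependTags (List.range m)

theorem det_prependTag (c : ℕ) : (prependTag c : Block ι (Fin 3) Unit).Det :=
  ((det_push _ _).seq <| (det_drain _ _).seq (det_drain _ _)).seq (det_pushAll _)

theorem det_prependTags (l : List ℕ) : (prependTags l : Block ι (Fin 3) Unit).Det := by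
  induction l with
  | nil => exact det_ret _
  | cons c l ih => exact ih.seq (det_prependTag c)

theorem det_writeTags {m : ℕ} (α : (Fin m → Bool) → Bool) :
    (writeTags α : Block ι (Fin 3) Unit).Det :=
  (det_pushAll _).seq (det_prependTags _)

variable {O : ι → Language Bool} (x w : List Bool) (coins : ℕ → Bool) (a : List ι)

theorem bitsFor_map {K : Type} [DecidableEq K] (k k' : K) (l : List Bool) :
    bitsFor k' (l.map fun b => (k, b)) = if k = k' then l else [] := by
  by_cases h : k = k' <;> simp [bitsFor, List.filter_map, Function.comp_def, h]

theorem runs_prependPair :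
    prependPair.Runs O ⟨![w, [], x], coins, a⟩ (6 * x.length + 3) ()
      ⟨![pair x w, [], x], coins, a⟩ := by
  have delimited : (push 0 false).Runs O ⟨![w, [], x], coins, a⟩ 1 ()
      ⟨![false :: w, [], x], coins, a⟩ := by
    refine (runs_push _ _ _).of_eq le_rfl (fun r => ?_) rfl rfl
    fin_cases r <;> simp
  have reversed : (drain 2 fun b => [(1, b)]).Runs O ⟨![false :: w, [], x], coins, a⟩
      (x.length * 2 + 1) () ⟨![false :: w, x.reverse, []], coins, a⟩ := by
    refine (runs_drain (c := 1) (by simp) (by simp) x _ rfl).of_eq le_rfl (fun r => ?_) rfl rfl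
    fin_cases r <;> simp [bitsFor]
  have copied : (drain 1 fun b => [(2, b), (0, b), (0, true)]).Runs O
      ⟨![false :: w, x.reverse, []], coins, a⟩ (x.length * 4 + 1) ()
      ⟨![pair x w, [], x], coins, a⟩ := by
    refine (runs_drain (c := 3) (by simp) (by simp) x.reverse _ rfl).of_eq (by simp)
      (fun r => ?_) rfl rfl
    fin_cases r <;> simp [bitsFor, pair, List.reverse_flatMap, Function.comp_def]
  exact (delimited.seq (reversed.seq copied)).mono (by omega)

theorem runs_prependTag (c : ℕ) :
    (prependTag c).Runs O ⟨![w, [], x], coins, a⟩ (6 * x.length + 2 * c + 5) ()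
      ⟨![pair (tag c x) w, [], x], coins, a⟩ := by
  refine ((runs_prependPair x w coins a).seq (runs_pushAll _ _)).of_eq
    (by simp; omega) (fun r => ?_) rfl rfl
  fin_cases r <;> simp [bitsFor, pair_tag]

theorem runs_prependTags (l : List ℕ) :
    (prependTags l).Runs O ⟨![w, [], x], coins, a⟩ (l.length * (6 * x.length + 5) + 2 * l.sum) ()
      ⟨![(l.map fun c => tag c x).foldr pair w, [], x], coins, a⟩ := by
  induction l with
  | nil => exact runs_ret _ _ _
  | cons c l ih =>
    refine (ih.seq (runs_prependTag x _ coins a c)).mono ?_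
    simp only [List.length_cons, List.sum_cons, Nat.add_mul]
    omega

theorem runs_writeTags {m : ℕ} (α : (Fin m → Bool) → Bool) :
    (writeTags α).Runs O ⟨![[], [], x], coins, a⟩
      (2 ^ m + (m * (6 * x.length + 5) + 2 * (List.range m).sum)) ()
      ⟨![encodeTT (fun i : Fin m => tag i x) α, [], x], coins, a⟩ := by
  have table : (pushAll ((truthTable α).reverse.map fun b => (0, b))).Runs O
      ⟨![[], [], x], coins, a⟩ (2 ^ m) () ⟨![truthTable α, [], x], coins, a⟩ := by
    refine (runs_pushAll _ _).of_eq (by simp [truthTable]) (fun r => ?_) rfl rfl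
    simp only [bitsFor_map]
    fin_cases r <;> simp
  have tags : (List.range m).map (fun c => tag c x) = List.ofFn fun i : Fin m => tag i x :=
    List.ext_getElem (by simp) (by simp)
  rw [encodeTT, ← tags]
  exact (table.seq (runs_prependTags x _ coins a _)).mono (by rw [List.length_range])

end Block

theorem PolyTimeComputable.of_block {K E : Type} [Finite K] [DecidableEq K] [Finite E]
    {B : Block Empty K E} (hdet : B.Det) {inp : K} {p : Polynomial ℕ}
    {e : (ℕ → Bool) → List Bool → E} {m : (ℕ → Bool) → List Bool → Mem Empty K}
    (hB : B.RunsIn inp p e m) {out : K} {f : List Bool → List Bool}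
    (hf : ∀ coins x, (m coins x).stk out = f x) : PolyTimeComputable f := by
  cases nonempty_fintype K
  cases nonempty_fintype E
  have accepting coins x := (hB coins x).seq (Block.runs_ret true _ 0)
  refine ⟨(B.seq (.ret true)).toMachine inp out, (hdet.seq (Block.det_ret _)).toMachine _ _,
    ⟨p, fun O coins x => ?_⟩, fun coins x => ?_⟩
  · obtain rfl : O = Empty.elim := Subsingleton.elim _ _
    obtain ⟨t, ht, h⟩ := (accepting coins x).halt (out := out)
    exact ⟨t, ht, _, h⟩
  · obtain ⟨t, -, h⟩ := (accepting coins x).run (out := out)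
    exact ⟨t, true, by rw [h]; rfl, by rw [h]; exact hf coins x⟩

open scoped Classical in
theorem IsP.polyTimeComputable_encodeTT_tag {F : List Bool → Prop} (hF : IsP F) {m : ℕ}
    (α : Bool → (Fin m → Bool) → Bool) :
    PolyTimeComputable fun x => encodeTT (fun i : Fin m => tag i x) (α (decide (F x))) := by
  obtain ⟨K, _, _, B, inp, p, b, c, hdet, hB, hb⟩ := hF
  obtain rfl : b = fun _ x => decide (F x) :=
    funext fun coins => funext fun x => Bool.eq_iff_iff.2 ((hb coins x).symm.trans (by simp))
  let write : Bool → Block Empty (K ⊕ Fin 3) Unit := fun f =>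
    (Block.writeTags (α f)).map id Sum.inr
  have written coins x := Block.Runs.map Sum.inr_injective (i := id) (O := Empty.elim)
    (Block.runs_writeTags x (c coins x).coins [] (α (decide (F x))))
    ⟨Sum.elim (c coins x).stk fun r : Fin 3 => if r = 2 then x else [], (c coins x).coins, []⟩ []
    (fun r => by fin_cases r <;> rfl) rfl rfl
  let q : Polynomial ℕ := 5 * Polynomial.X + 2 + p +
    (2 ^ m + (.C m * (6 * Polynomial.X + 5) + 2 * .C (List.range m).sum))
  have runs : ((B.dup inp).bind write).RunsIn (.inr 0) q _ _ := fun coins x =>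
    ((hB coins x).dup.bind (C := write) (written coins x)).mono <| by
      simp only [q, Polynomial.eval_add, Polynomial.eval_mul, Polynomial.eval_pow,
        Polynomial.eval_C, Polynomial.eval_X, Polynomial.eval_ofNat, le_refl]
  exact .of_block ((hdet.dup inp).bind fun f => (Block.det_writeTags _).map _ _) runs
    (out := .inr 0) fun coins x => Sum.inr_injective.extend_apply _ _ _

theorem mindChange_subset_RTT (m : ℕ) : MindChange m ⊆ RTT m NP := by
  classical
  rintro L ⟨F, hF, N, hN, hle, hL⟩
  let C : Language Bool := {w | ∃ c : Fin m, ∃ x, w = tag c x ∧ c + 1 ≤ N x}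
  have mem_C (i : Fin m) (x : List Bool) : tag i x ∈ C ↔ i < N x := by
    refine ⟨fun ⟨c, x', h, hc⟩ => ?_, fun h => ⟨i, x, rfl, h⟩⟩
    obtain ⟨hi, rfl⟩ := tag_inj.1 h
    rwa [hi]
  refine ⟨C, IsNP.exists fun c : Fin m => (hN (c + 1)).tag c, fun x i => tag i x, _,
    hF.polyTimeComputable_encodeTT_tag fun f v =>
      f == decide (Even (Finset.univ.filter fun i => v i = true).card), fun x => ?_⟩
  simp only [hL, mem_C, decide_eq_true_iff, Fin.card_filter_val_lt, min_eq_right (hle x),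
    beq_iff_eq, decide_eq_decide]

theorem RTT_eq_mindChange (m : ℕ) : RTT m NP = MindChange m :=
  (RTT_subset_mindChange m).antisymm (mindChange_subset_RTT m)

end QueryOrder

theorem theorem3p6 (j k : ℕ) (hj : 1 ≤ j) (hk : 1 ≤ k) :
    QueryOrder.POneOne (QueryOrder.BH j) (QueryOrder.BH k) =
      if Even j ∧ Odd k then QueryOrder.RTT (j + 2 * k - 1) QueryOrder.NP
      else QueryOrder.RTT (j + 2 * k) QueryOrder.NP := by
  rw [QueryOrder.BH_eq_oddRank hj, QueryOrder.BH_eq_oddRank hk, QueryOrder.RTT_eq_mindChange,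
    QueryOrder.RTT_eq_mindChange]
  have odd_pred (hj' : Even j) : Odd (j - 1) := Nat.Even.sub_odd hj hj' odd_one
  split_ifs with h
  · obtain ⟨hj', hk'⟩ := h
    refine (QueryOrder.POneOne_subset_mindChange fun _ _ _ =>
      QueryOrder.Alternates.le_of_even_of_odd hj' hk').antisymm ?_
    rw [show j + 2 * k - 1 = j - 1 + 0 + 2 * k by omega]
    exact QueryOrder.mindChange_subset_POneOne (odd_pred hj') (by omega) (.inl rfl)
  · refine (QueryOrder.POneOne_subset_mindChange fun _ _ _ =>
      QueryOrder.Alternates.le_add_two_mul).antisymm ?_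
    rcases Nat.even_or_odd j with hj' | hj'
    · have hk' : Even k := Nat.not_odd_iff_even.1 fun hk' => h ⟨hj', hk'⟩
      rw [show j + 2 * k = j - 1 + 1 + 2 * k by omega]
      exact QueryOrder.mindChange_subset_POneOne (odd_pred hj') (by omega) (.inr ⟨rfl, hk'⟩)
    · exact QueryOrder.mindChange_subset_POneOne (e := 0) hj' le_rfl (.inl rfl)
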